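/- Let $d\ge 1$, let $\Omega\subset\mathbb{R}^d$ be compact and connected, and let $U$ be the interior of $\Omega$; function spaces on $\Omega$ are those on the open set $U$, and $H^1_0(\Omega)$ is the closure of $C_c^\infty(U)$ in $H^1(U)$. Let $V\in H^2(U)\cap L^\infty(U)$, let $W\in H^2(U-U)\cap L^\infty(U-U)$, where $U-U=\{x-y : x,y\in U\}$, and let $A,B\in\mathbb{R}$. Then there is $C_0>0$, depending on $\Omega,V,W,A,B$, such that for every $C\ge C_0$ the zero function is the unique stationary state in $H^1_0(\Omega)$ of $$\rho_t = A\,\nabla\cdot(\nabla V\,\rho) + B\,\nabla\cdot\big((\nabla W*\rho)\,\rho\big) + C\,\Delta\rho ,\qquad (\nabla W*\rho)(x)=\int_{U}\nabla W(x-y)\,\rho(y)\,dy .$$ Here $\rho\in H^1_0(\Omega)$ is called a stationary state if it satisfies the stationary equation weakly, that is, $$\int_{U}\big(A\,\rho\,\nabla V + B\,\rho\,(\nabla W*\rho)+C\,\nabla\rho\big)\cdot\nabla\varphi\,dx=0\qquad\text{for all }\varphi\in C_c^\infty(U),$$ and functions that agree almost everywhere on $U$ are identified. -/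

import Mathlib

open MeasureTheory Filter Topology
open scoped ContDiff Pointwise

noncomputable section

namespace AggregationDiffusion

/-- Euclidean space `ℝ^d`. -/
abbrev E (d : ℕ) : Type := EuclideanSpace ℝ (Fin d)

/-- `φ ∈ C_c^∞(U)`: a smooth real function with compact support contained in `U`. -/
def IsTestFunction {d : ℕ} (U : Set (E d)) (φ : E d → ℝ) : Prop :=
  ContDiff ℝ ∞ φ ∧ HasCompactSupport φ ∧ tsupport φ ⊆ U

/-- On the open set `U`, the locally integrable function `g` is the weak `i`-th partial derivative
of the locally integrable function `f`: `∫_U f ∂ᵢφ = - ∫_U g φ` for all `φ ∈ C_c^∞(U)`. -/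
def HasWeakPartialDeriv {d : ℕ} (U : Set (E d)) (i : Fin d) (f g : E d → ℝ) : Prop :=
  LocallyIntegrableOn f U ∧ LocallyIntegrableOn g U ∧
    ∀ φ : E d → ℝ, IsTestFunction U φ →
      ∫ x in U, f x * fderiv ℝ φ x (EuclideanSpace.single i 1) = - ∫ x in U, g x * φ x

/-- The vector field `g` is the weak gradient of `f` on the open set `U`
(unique up to equality almost everywhere on `U`). -/
def HasWeakGradient {d : ℕ} (U : Set (E d)) (f : E d → ℝ) (g : E d → E d) : Prop :=
  ∀ i : Fin d, HasWeakPartialDeriv U i f (fun x => g x i)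

/-- `f ∈ H¹(U)`: `f` and its weak gradient are square integrable on `U`. -/
def MemH1 {d : ℕ} (U : Set (E d)) (f : E d → ℝ) : Prop :=
  MemLp f 2 (volume.restrict U) ∧
    ∃ g : E d → E d, HasWeakGradient U f g ∧ MemLp g 2 (volume.restrict U)

/-- `f ∈ H²(U)`: `f` is square integrable on `U` and has a square integrable weak gradient there
whose components all belong to `H¹(U)`. -/
def MemH2 {d : ℕ} (U : Set (E d)) (f : E d → ℝ) : Prop :=
  MemLp f 2 (volume.restrict U) ∧
    ∃ g : E d → E d, HasWeakGradient U f g ∧ MemLp g 2 (volume.restrict U) ∧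
      ∀ i : Fin d, MemH1 U (fun x => g x i)

/-- `f ∈ L^∞(U)`. -/
def MemLinfty {d : ℕ} (U : Set (E d)) (f : E d → ℝ) : Prop :=
  MemLp f ⊤ (volume.restrict U)

/-- `f ∈ H¹₀(U)`: `f` belongs to the closure of `C_c^∞(U)` in `H¹(U)`, that is, `f` has a square
integrable weak gradient `g`, and some sequence of test functions `φₙ` satisfies
`φₙ → f` and `∇φₙ → g` in `L²(U)`. -/
def MemH10 {d : ℕ} (U : Set (E d)) (f : E d → ℝ) : Prop :=
  MemLp f 2 (volume.restrict U) ∧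
    ∃ g : E d → E d, HasWeakGradient U f g ∧ MemLp g 2 (volume.restrict U) ∧
      ∃ φ : ℕ → E d → ℝ, (∀ n, IsTestFunction U (φ n)) ∧
        Tendsto (fun n => eLpNorm (fun x => φ n x - f x) 2 (volume.restrict U)) atTop (𝓝 0) ∧
        Tendsto (fun n => eLpNorm (fun x => gradient (φ n) x - g x) 2 (volume.restrict U))
          atTop (𝓝 0)

/-- The convolution `(F * ρ)(x) = ∫_U ρ(y) F(x - y) dy` of a vector field `F` with a density `ρ`
on `U` (extended by zero outside `U`). For `x ∈ U` it uses only the values of `F` on `U - U`. -/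
def convOn {d : ℕ} (U : Set (E d)) (F : E d → E d) (ρ : E d → ℝ) (x : E d) : E d :=
  ∫ y in U, ρ y • F (x - y)

/-- `ρ ∈ H¹₀(U)` is a (weak) stationary state of
`ρ_t = A ∇·(∇V ρ) + B ∇·((∇W * ρ) ρ) + C Δρ` on the open set `U`: the flux
`A ρ ∇V + B ρ (∇W * ρ) + C ∇ρ` is weakly divergence free in `U`. Here `gV`, `gW`, `gρ` are the weak
gradients of `V` on `U`, of `W` on the open set of differences `U - U`, and of `ρ` on `U`;
they are unique almost everywhere, so their choice does not matter. -/
def IsStationaryState {d : ℕ} (U : Set (E d)) (V W : E d → ℝ) (A B C : ℝ) (ρ : E d → ℝ) : Prop :=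
  MemH10 U ρ ∧
    ∃ gV gW gρ : E d → E d,
      HasWeakGradient U V gV ∧ HasWeakGradient (U - U) W gW ∧ HasWeakGradient U ρ gρ ∧
      ∀ φ : E d → ℝ, IsTestFunction U φ →
        ∫ x in U, inner ℝ
          (A • ρ x • gV x + B • ρ x • convOn U gW ρ x + C • gρ x) (gradient φ x) = 0

end AggregationDiffusion

end

/-! For fixed `ρ` the nonlocal equation is a linear Fokker–Planck equation. Put `Φ = (A V + B W * ρ)
/ C` and `b = ∇Φ`. Dividing by `C` turns stationarity into `∇·(∇ρ + ρ b) = 0`, and the flux `∇ρ + ρ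
b` is `exp (-Φ) ∇u` for `u = ρ exp Φ`. Since `V` is bounded and `W * ρ` is bounded by
Cauchy–Schwarz, `Φ` is bounded. Formally, testing with `arctan u`, whose gradient is a positive
weight times the flux, gives `∫ weight * |∇ρ + ρ b|² = 0`. So the flux vanishes, `arctan u` has zero
gradient and zero boundary values, and `ρ = 0`. Only `C > 0` is needed.

The difficulty is integrability: `ρ b` is a product of two `L²` functions, so it cannot be paired
with gradients that converge only in `L²`. Two devices resolve this. First, `V` and `W` are in `H²`,
so `∇·b = h` is in `L²`, and `integral_mul_inner_gradient_eq_neg` replaces `∫ ρ b·∇φ` by integrals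
in which `φ` appears undifferentiated. Second, `arctan` is bounded, and the weight multiplied by
`1`, `ρ` or `ρ²` stays bounded, so every limit has the form treated in `tendsto_integral_mul_inner`.

The test functions are `arctan (s exp p)`, with `s → ρ` from the definition of `H¹₀` and `p` a
mollification of `Φ` near the support of `s`; no regularity of the boundary enters.
`ae_eq_zero_of_weak_solution` carries out this argument for a general bounded potential, and
`IsStationaryState.ae_eq_zero` supplies the potential. -/

namespace AggregationDiffusion

open scoped Convolution ENNReal

/-! ### Limits of integrals of weighted inner products -/

section Limits

variable {α F : Type*} [MeasurableSpace α] {μ : Measure α} [NormedAddCommGroup F]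
  [InnerProductSpace ℝ F]

theorem integrable_inner_of_memLp {f g : α → F} (hf : MemLp f 2 μ) (hg : MemLp g 2 μ) :
    Integrable (fun x => (inner ℝ (f x) (g x) : ℝ)) μ := by
  rw [← memLp_one_iff_integrable]
  exact hf.of_bilin (q := 2) (fun a b => (inner ℝ a b : ℝ)) 1 hg (hf.1.inner hg.1)
    (Eventually.of_forall fun x => by
      rw [one_mul]; exact_mod_cast norm_inner_le_norm (𝕜 := ℝ) (f x) (g x))

/-- Split `fs n = f + (fs n - f)`: the first part converges by dominated convergence with majorant
`M |⟨q, f⟩|`, and the second is at most `M ‖q‖ ‖fs n - f‖` in `L²` norms. The coefficients need only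
a uniform bound and pointwise convergence, which is all that nonlinear functions of `ρ` and `Φ`
provide. -/
theorem tendsto_integral_mul_inner {q f : α → F} {fs : ℕ → α → F} {β : α → ℝ} {βs : ℕ → α → ℝ}
    {M : ℝ} (hq : MemLp q 2 μ) (hf : MemLp f 2 μ) (hfs : ∀ n, MemLp (fs n) 2 μ)
    (hlim : Tendsto (fun n => eLpNorm (fun x => fs n x - f x) 2 μ) atTop (𝓝 0))
    (hβm : ∀ n, AEStronglyMeasurable (βs n) μ) (hβM : ∀ n, ∀ᵐ x ∂μ, |βs n x| ≤ M)
    (hβ : ∀ᵐ x ∂μ, Tendsto (fun n => βs n x) atTop (𝓝 (β x))) :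
    Tendsto (fun n => ∫ x, βs n x * inner ℝ (q x) (fs n x) ∂μ) atTop
      (𝓝 (∫ x, β x * inner ℝ (q x) (f x) ∂μ)) := by
  have hqf : Integrable (fun x => inner ℝ (q x) (f x)) μ := integrable_inner_of_memLp hq hf
  have hd : ∀ n, MemLp (fun x => fs n x - f x) 2 μ := fun n => (hfs n).sub hf
  have hqd : ∀ n, Integrable (fun x => inner ℝ (q x) (fs n x - f x)) μ :=
    fun n => integrable_inner_of_memLp hq (hd n)
  have hbd : ∀ {g : α → ℝ}, Integrable g μ → ∀ n, Integrable (fun x => βs n x * g x) μ :=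
    fun hg n => hg.bdd_mul (hβm n) (hβM n)
  have h1 : Tendsto (fun n => ∫ x, βs n x * inner ℝ (q x) (f x) ∂μ) atTop
      (𝓝 (∫ x, β x * inner ℝ (q x) (f x) ∂μ)) := by
    refine tendsto_integral_of_dominated_convergence
      (fun x => M * ‖(inner ℝ (q x) (f x) : ℝ)‖) (fun n => (hbd hqf n).1) (hqf.norm.const_mul M)
      (fun n => ?_) ?_
    · filter_upwards [hβM n] with x hx
      rw [norm_mul]
      exact mul_le_mul_of_nonneg_right hx (norm_nonneg _)
    · filter_upwards [hβ] with x hx using hx.mul_const _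
  have h2 : Tendsto (fun n => ∫ x, βs n x * inner ℝ (q x) (fs n x - f x) ∂μ) atTop (𝓝 0) := by
    rw [tendsto_zero_iff_enorm_tendsto_zero]
    have hb : ∀ n, ‖∫ x, βs n x * inner ℝ (q x) (fs n x - f x) ∂μ‖ₑ ≤
        ENNReal.ofReal M * (eLpNorm q 2 μ * eLpNorm (fun x => fs n x - f x) 2 μ) := by
      intro n
      refine (enorm_integral_le_lintegral_enorm _).trans ?_
      rw [← eLpNorm_one_eq_lintegral_enorm]
      refine (eLpNorm_le_mul_eLpNorm_of_ae_le_mul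
        (g := fun x => (inner ℝ (q x) (fs n x - f x) : ℝ)) (c := M) ?_ 1).trans ?_
      · filter_upwards [hβM n] with x hx
        rw [norm_mul]
        exact mul_le_mul_of_nonneg_right hx (norm_nonneg _)
      · gcongr
        have := eLpNorm_le_eLpNorm_mul_eLpNorm_of_nnnorm (p := 2) (q := 2) (r := 1) (μ := μ)
          hq.1 (hd n).1 (fun a b => (inner ℝ a b : ℝ)) 1
          (Eventually.of_forall fun x => by
            rw [one_mul]; exact_mod_cast norm_inner_le_norm (𝕜 := ℝ) (q x) (fs n x - f x))
        simpa using this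
    have hz : Tendsto (fun n => ENNReal.ofReal M *
        (eLpNorm q 2 μ * eLpNorm (fun x => fs n x - f x) 2 μ)) atTop (𝓝 0) := by
      have := ENNReal.Tendsto.const_mul (a := ENNReal.ofReal M)
        (ENNReal.Tendsto.const_mul (a := eLpNorm q 2 μ) hlim (Or.inr hq.2.ne))
        (Or.inr ENNReal.ofReal_ne_top)
      simpa using this
    exact tendsto_of_tendsto_of_tendsto_of_le_of_le tendsto_const_nhds hz (fun _ => zero_le) hb
  have h3 := h2.add h1
  rw [zero_add] at h3
  refine h3.congr fun n => ?_
  rw [← integral_add (hbd (hqd n) n) (hbd hqf n)]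
  refine integral_congr_ae (Eventually.of_forall fun x => ?_)
  simp only [inner_sub_right]
  ring

end Limits

/-! ### Mollification in `L²` -/

section Mollification

variable {G F : Type*} [NormedAddCommGroup G] [NormedSpace ℝ G] [FiniteDimensional ℝ G]
  [MeasurableSpace G] [BorelSpace G] {μ : Measure G} [μ.IsAddHaarMeasure]
  [NormedAddCommGroup F] [NormedSpace ℝ F]

/-- The bump is a probability density, so Cauchy–Schwarz with respect to it bounds `|η * f|²`
pointwise by `η * |f|²`; Tonelli and translation invariance finish. -/
theorem eLpNorm_two_normed_convolution_le (η : ContDiffBump (0 : G)) {f : G → F}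
    (hf : AEStronglyMeasurable f μ) :
    eLpNorm (η.normed μ ⋆[ContinuousLinearMap.lsmul ℝ ℝ, μ] f) 2 μ ≤ eLpNorm f 2 μ := by
  have hη : ∫⁻ t, ‖η.normed μ t‖ₑ ∂μ = 1 := by
    have := ofReal_integral_norm_eq_lintegral_enorm (η.integrable_normed (μ := μ))
    rw [← this]
    simp_rw [Real.norm_of_nonneg (η.nonneg_normed _), η.integral_normed, ENNReal.ofReal_one]
  have hηm : Measurable fun t => ‖η.normed μ t‖ₑ := η.continuous_normed.enorm.measurable
  have hfp : AEMeasurable (fun z : G × G => ‖f (z.1 - z.2)‖ₑ) (μ.prod μ) :=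
    (hf.comp_quasiMeasurePreserving
      (quasiMeasurePreserving_sub_of_right_invariant μ μ)).enorm
  have hpt : ∀ x, ‖(η.normed μ ⋆[ContinuousLinearMap.lsmul ℝ ℝ, μ] f) x‖ₑ ^ (2 : ℝ) ≤
      ∫⁻ t, ‖η.normed μ t‖ₑ * ‖f (x - t)‖ₑ ^ (2 : ℝ) ∂μ := by
    intro x
    have hfx : AEMeasurable (fun t => ‖f (x - t)‖ₑ) μ :=
      (hf.comp_quasiMeasurePreserving (quasiMeasurePreserving_sub_left_of_right_invariant μ x)).enorm
    have h1 : ‖(η.normed μ ⋆[ContinuousLinearMap.lsmul ℝ ℝ, μ] f) x‖ₑ ≤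
        ∫⁻ t, ‖η.normed μ t‖ₑ * ‖f (x - t)‖ₑ ∂μ := by
      refine (enorm_integral_le_lintegral_enorm _).trans (le_of_eq ?_)
      simp [enorm_smul]
    -- Hölder for `η = η^(1/2) * η^(1/2)`, with one factor kept next to `|f|`.
    have h2 := ENNReal.lintegral_mul_norm_pow_le (μ := μ) (p := 1 / 2) (q := 1 / 2)
      (f := fun t => ‖η.normed μ t‖ₑ) (g := fun t => ‖η.normed μ t‖ₑ * ‖f (x - t)‖ₑ ^ (2 : ℝ))
      hηm.aemeasurable (hηm.aemeasurable.mul (hfx.pow_const _)) (by norm_num) (by norm_num)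
      (by norm_num)
    rw [hη, ENNReal.one_rpow, one_mul] at h2
    have h3 : ∀ t, ‖η.normed μ t‖ₑ ^ (1 / 2 : ℝ) *
        (‖η.normed μ t‖ₑ * ‖f (x - t)‖ₑ ^ (2 : ℝ)) ^ (1 / 2 : ℝ) =
        ‖η.normed μ t‖ₑ * ‖f (x - t)‖ₑ := by
      intro t
      rw [ENNReal.mul_rpow_of_nonneg _ _ (by norm_num), ← mul_assoc, ← ENNReal.rpow_mul,
        ← ENNReal.rpow_add_of_nonneg _ _ (by norm_num) (by norm_num)]
      norm_num
    simp_rw [h3] at h2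
    calc _ ≤ ((∫⁻ t, ‖η.normed μ t‖ₑ * ‖f (x - t)‖ₑ ^ (2 : ℝ) ∂μ) ^ (1 / 2 : ℝ)) ^ (2 : ℝ) := by
          gcongr
          exact h1.trans h2
      _ = _ := by rw [← ENNReal.rpow_mul]; norm_num
  rw [eLpNorm_eq_lintegral_rpow_enorm_toReal (by norm_num) (by norm_num),
    eLpNorm_eq_lintegral_rpow_enorm_toReal (by norm_num) (by norm_num)]
  simp only [ENNReal.toReal_ofNat]
  gcongr ?_ ^ _
  calc _ ≤ ∫⁻ x, ∫⁻ t, ‖η.normed μ t‖ₑ * ‖f (x - t)‖ₑ ^ (2 : ℝ) ∂μ ∂μ := lintegral_mono hpt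
    _ = ∫⁻ t, ∫⁻ x, ‖η.normed μ t‖ₑ * ‖f (x - t)‖ₑ ^ (2 : ℝ) ∂μ ∂μ := by
        refine lintegral_lintegral_swap ?_
        exact (hηm.comp measurable_snd).aemeasurable.mul (hfp.pow_const _)
    _ = ∫⁻ t, ‖η.normed μ t‖ₑ * ∫⁻ x, ‖f x‖ₑ ^ (2 : ℝ) ∂μ ∂μ := by
        refine lintegral_congr fun t => ?_
        rw [lintegral_const_mul' _ _ enorm_ne_top]
        congr 1
        exact lintegral_sub_right_eq_self (fun x => ‖f x‖ₑ ^ (2 : ℝ)) t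
    _ = ∫⁻ x, ‖f x‖ₑ ^ (2 : ℝ) ∂μ := by
        rw [lintegral_mul_const _ hηm, hη, one_mul]

/-- Approximate `f` by a continuous compactly supported `g`; the contraction bound handles `f - g`
and uniform continuity handles `g`. The radius works for every smaller bump, so a single bump can
later serve a function and its gradient. -/
theorem exists_forall_eLpNorm_normed_convolution_sub_le [CompleteSpace F] {f : G → F} (hf : MemLp f 2 μ)
    {δ : ℝ≥0∞} (hδ : δ ≠ 0) :
    ∃ r > 0, ∀ η : ContDiffBump (0 : G), η.rOut ≤ r →
      eLpNorm (fun x => (η.normed μ ⋆[ContinuousLinearMap.lsmul ℝ ℝ, μ] f) x - f x) 2 μ ≤ δ := by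
  have hδ3 : δ / 3 ≠ 0 := by simp [hδ]
  obtain ⟨g, hgs, hfg, hgc, hg⟩ := hf.exists_hasCompactSupport_eLpNorm_sub_le (by norm_num) hδ3
  -- Bumps of radius at most `1` keep `η * g - g` supported in this fixed compact set, so a uniform
  -- error `ε` costs `μ T ^ (1/2) * ε` in `L²`.
  set T := Metric.cthickening 1 (tsupport g) with hT
  have hTc : IsCompact T := hgs.isCompact.cthickening
  obtain ⟨ε, hε, hεT⟩ : ∃ ε : ℝ, 0 < ε ∧ μ T ^ (1 / 2 : ℝ) * ENNReal.ofReal ε ≤ δ / 3 := by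
    have hfin : μ T ^ (1 / 2 : ℝ) ≠ ⊤ :=
      ENNReal.rpow_ne_top_of_nonneg (by norm_num) hTc.measure_lt_top.ne
    have ht : Tendsto (fun ε : ℝ => μ T ^ (1 / 2 : ℝ) * ENNReal.ofReal ε) (𝓝[>] 0) (𝓝 0) := by
      have := ENNReal.Tendsto.const_mul (a := μ T ^ (1 / 2 : ℝ))
        (ENNReal.tendsto_ofReal (tendsto_id (x := 𝓝 (0 : ℝ)))) (Or.inr hfin)
      simp only [id, ENNReal.ofReal_zero, mul_zero] at this
      exact this.mono_left nhdsWithin_le_nhds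
    obtain ⟨ε, h1, h2⟩ := ((ht.eventually_lt_const (pos_iff_ne_zero.2 hδ3)).and
      self_mem_nhdsWithin).exists
    exact ⟨ε, h2, h1.le⟩
  obtain ⟨r, hr, hgr⟩ := Metric.uniformContinuous_iff.1
    (hgs.uniformContinuous_of_continuous hgc) ε hε
  refine ⟨min r 1, lt_min hr one_pos, fun η hη => ?_⟩
  have hηr : η.rOut ≤ r := hη.trans (min_le_left _ _)
  have hη1 : η.rOut ≤ 1 := hη.trans (min_le_right _ _)
  set L := ContinuousLinearMap.lsmul ℝ ℝ (E := F) with hL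
  have hfl : LocallyIntegrable f μ := hf.locallyIntegrable (by norm_num)
  have hgl : LocallyIntegrable g μ := hg.locallyIntegrable (by norm_num)
  have hce : ∀ {k : G → F}, LocallyIntegrable k μ → ConvolutionExists (η.normed μ) k L μ :=
    fun hk => η.hasCompactSupport_normed.convolutionExists_left L η.continuous_normed hk
  have hmeas : ∀ {k : G → F}, LocallyIntegrable k μ →
      AEStronglyMeasurable (η.normed μ ⋆[L, μ] k) μ := fun hk =>
    (η.hasCompactSupport_normed.continuous_convolution_left L η.continuous_normed
      hk).aestronglyMeasurable
  have hsplit : (fun x => (η.normed μ ⋆[L, μ] f) x - f x) =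
      ((η.normed μ ⋆[L, μ] (f - g)) + fun x => (η.normed μ ⋆[L, μ] g) x - g x) + (g - f) := by
    have : f = (f - g) + g := by simp
    funext x
    conv_lhs => rw [this, (hce (hfl.sub hgl)).distrib_add (hce hgl)]
    simp
    abel
  rw [hsplit]
  have hm1 := hmeas (hfl.sub hgl)
  have hm2 : AEStronglyMeasurable (fun x => (η.normed μ ⋆[L, μ] g) x - g x) μ :=
    (hmeas hgl).sub hg.1
  have h1 : eLpNorm (η.normed μ ⋆[L, μ] (f - g)) 2 μ ≤ δ / 3 :=
    (eLpNorm_two_normed_convolution_le η (hf.1.sub hg.1)).trans hfg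
  have h3 : eLpNorm (g - f) 2 μ ≤ δ / 3 := by
    rwa [eLpNorm_sub_comm]
  have h2 : eLpNorm (fun x => (η.normed μ ⋆[L, μ] g) x - g x) 2 μ ≤ δ / 3 := by
    have hb : ∀ x, ‖(η.normed μ ⋆[L, μ] g) x - g x‖ ≤ T.indicator (fun _ => ε) x := by
      intro x
      by_cases hx : x ∈ T
      · rw [Set.indicator_of_mem hx, ← dist_eq_norm]
        refine η.dist_normed_convolution_le hg.1 fun y hy => (hgr ?_).le
        exact (Metric.mem_ball.1 hy).trans_le hηr
      · have hz : ∀ y ∈ Metric.ball x η.rOut, g y = 0 := by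
          intro y hy
          by_contra hne
          refine hx (Metric.mem_cthickening_of_dist_le x y 1 _ (subset_tsupport _ hne) ?_)
          rw [dist_comm]
          exact (Metric.mem_ball.1 hy).le.trans hη1
        have hx0 : g x = 0 := hz x (Metric.mem_ball_self η.rOut_pos)
        rw [Set.indicator_of_notMem hx, η.normed_convolution_eq_right
          (fun y hy => by rw [hz y hy, hx0])]
        simp
    have hTm : MeasurableSet T := Metric.isClosed_cthickening.measurableSet
    calc _ ≤ eLpNorm (T.indicator (fun _ => ε)) 2 μ := eLpNorm_mono_real hb
      _ = μ T ^ (1 / 2 : ℝ) * ENNReal.ofReal ε := by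
          rw [eLpNorm_indicator_const hTm (by norm_num) (by norm_num), mul_comm,
            Real.enorm_of_nonneg hε.le]
          norm_num
      _ ≤ δ / 3 := hεT
  calc _ ≤ (δ / 3 + δ / 3) + δ / 3 := by
        refine (eLpNorm_add_le (hm1.add hm2) (hg.1.sub hf.1) (by norm_num)).trans ?_
        refine add_le_add ((eLpNorm_add_le hm1 hm2 (by norm_num)).trans (add_le_add h1 h2)) h3
    _ = δ := ENNReal.add_thirds δ

end Mollification

/-! ### Smooth approximation of a function and its weak gradient on compact subsets -/

section SmoothApproximation

variable {d : ℕ}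

theorem gradient_apply_eq_fderiv (f : E d → ℝ) (x : E d) (i : Fin d) :
    gradient f x i = fderiv ℝ f x (EuclideanSpace.single i 1) := by
  have h := inner_gradient_left (𝕜 := ℝ) (f := f) (x := x) (y := EuclideanSpace.single i 1)
  rw [EuclideanSpace.inner_single_right] at h
  simpa using h

theorem continuous_gradient {φ : E d → ℝ} (hφ : ContDiff ℝ ∞ φ) : Continuous (gradient φ) :=
  (InnerProductSpace.toDual ℝ (E d)).symm.continuous.comp (hφ.continuous_fderiv (by simp))

theorem tsupport_gradient_subset (φ : E d → ℝ) : tsupport (gradient φ) ⊆ tsupport φ := by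
  refine (closure_mono fun x hx => ?_).trans (tsupport_fderiv_subset ℝ (f := φ))
  contrapose! hx
  simp only [Function.mem_support, not_not] at hx ⊢
  simp [gradient, hx]

theorem hasCompactSupport_gradient {φ : E d → ℝ} (hφ : HasCompactSupport φ) :
    HasCompactSupport (gradient φ) :=
  hφ.of_isClosed_subset (isClosed_tsupport _) (tsupport_gradient_subset φ)

theorem isTestFunction_normed_sub {U : Set (E d)} (η : ContDiffBump (0 : E d)) {x : E d}
    (hx : Metric.closedBall x η.rOut ⊆ U) :
    IsTestFunction U (fun y => η.normed volume (x - y)) := by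
  have hs : tsupport (fun y => η.normed volume (x - y)) ⊆ Metric.closedBall x η.rOut := by
    refine closure_minimal (fun y hy => ?_) Metric.isClosed_closedBall
    have : x - y ∈ Function.support (η.normed (volume : Measure (E d))) := hy
    rw [η.support_normed_eq, Metric.mem_ball, dist_zero_right] at this
    rw [Metric.mem_closedBall, dist_comm, dist_eq_norm]
    exact this.le
  refine ⟨(η.contDiff_normed (n := ⊤)).comp (contDiff_const.sub contDiff_id), ?_, hs.trans hx⟩
  exact (isCompact_closedBall x η.rOut).of_isClosed_subset (isClosed_tsupport _) hs

/-- When the ball around `x` lies in `U`, the reflected bump `y ↦ η (x - y)` is an admissible test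
function. The sign from differentiating the reflection cancels the sign in the weak derivative. -/
theorem gradient_normed_convolution_eq {U : Set (E d)} (hU : IsOpen U) {Φ : E d → ℝ}
    {b : E d → E d} (hΦ : HasWeakGradient U Φ b) (hΦ1 : LocallyIntegrable (U.indicator Φ))
    (hb1 : LocallyIntegrable (U.indicator b)) (η : ContDiffBump (0 : E d)) {x : E d}
    (hx : Metric.closedBall x η.rOut ⊆ U) :
    gradient (η.normed volume ⋆[ContinuousLinearMap.lsmul ℝ ℝ, volume] U.indicator Φ) x =
      (η.normed volume ⋆[ContinuousLinearMap.lsmul ℝ ℝ, volume] U.indicator b) x := by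
  have hηd : ContDiff ℝ ∞ (η.normed (volume : Measure (E d))) := η.contDiff_normed (n := ⊤)
  have hηc := η.hasCompactSupport_normed (μ := (volume : Measure (E d)))
  have hder := hηc.hasFDerivAt_convolution_left (ContinuousLinearMap.lsmul ℝ ℝ (E := ℝ))
    (hηd.of_le (by simp)) hΦ1 x
  have hex : ConvolutionExistsAt (fderiv ℝ (η.normed volume)) (U.indicator Φ) x
      ((ContinuousLinearMap.lsmul ℝ ℝ (E := ℝ)).precompL (E d)) volume :=
    (hηc.fderiv ℝ).convolutionExists_left _ (hηd.continuous_fderiv (by simp)) hΦ1 x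
  have hex2 : ConvolutionExistsAt (η.normed volume) (U.indicator b) x
      (ContinuousLinearMap.lsmul ℝ ℝ) volume :=
    hηc.convolutionExists_left _ η.continuous_normed hb1 x
  ext i
  rw [gradient_apply_eq_fderiv, hder.fderiv]
  have hleft : ((fderiv ℝ (η.normed volume) ⋆[(ContinuousLinearMap.lsmul ℝ ℝ (E := ℝ)).precompL
      (E d), volume] U.indicator Φ) x) (EuclideanSpace.single i 1) =
      ∫ y, U.indicator Φ y * fderiv ℝ (η.normed volume) (x - y) (EuclideanSpace.single i 1) := by
    rw [convolution_def, ContinuousLinearMap.integral_apply hex,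
      ← integral_sub_left_eq_self _ volume x]
    refine integral_congr_ae (Eventually.of_forall fun y => ?_)
    simp [ContinuousLinearMap.precompL_apply, mul_comm]
  have hright : ((η.normed volume ⋆[ContinuousLinearMap.lsmul ℝ ℝ, volume] U.indicator b) x) i =
      ∫ y, U.indicator (fun y => b y i) y * η.normed volume (x - y) := by
    rw [convolution_def]
    have := (EuclideanSpace.proj (𝕜 := ℝ) i : E d →L[ℝ] ℝ).integral_comp_comm hex2
    refine Eq.trans this.symm ?_
    rw [← integral_sub_left_eq_self _ volume x]
    refine integral_congr_ae (Eventually.of_forall fun y => ?_)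
    by_cases hy : y ∈ U <;> simp [hy, mul_comm]
  rw [hleft, hright]
  have hw := (hΦ i).2.2 _ (isTestFunction_normed_sub η hx)
  have hfd : ∀ y, fderiv ℝ (fun y => η.normed volume (x - y)) y (EuclideanSpace.single i 1) =
      - fderiv ℝ (η.normed volume) (x - y) (EuclideanSpace.single i 1) := by
    intro y
    have hη := (hηd.differentiable (by simp) (x - y)).hasFDerivAt.comp y
      ((hasFDerivAt_id y).const_sub x)
    rw [show (fun y => η.normed volume (x - y)) = η.normed volume ∘ HSub.hSub x from rfl,
      hη.fderiv]
    simp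
  simp only [hfd, mul_neg, integral_neg, neg_inj] at hw
  have hind : ∀ k l : E d → ℝ, ∫ y, U.indicator k y * l y = ∫ y in U, k y * l y := by
    intro k l
    rw [← integral_indicator hU.measurableSet]
    simp_rw [Set.indicator_mul_left]
  rw [hind, hind]
  exact hw

/-- Mollify the extension by zero at a scale below the distance from `K` to the complement of `U`.
Averaging against a probability density preserves the bound `M`, which keeps the exponential weights
under control uniformly. -/
theorem exists_contDiff_approx_of_hasWeakGradient {U : Set (E d)} (hU : IsOpen U) {Φ : E d → ℝ}
    {b : E d → E d} {M : ℝ} (hM : 0 ≤ M) (hΦ : HasWeakGradient U Φ b)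
    (hΦM : ∀ᵐ x ∂volume.restrict U, |Φ x| ≤ M) (hΦ2 : MemLp Φ 2 (volume.restrict U))
    (hb2 : MemLp b 2 (volume.restrict U)) {K : Set (E d)} (hK : IsCompact K) (hKU : K ⊆ U)
    {δ : ℝ≥0∞} (hδ : δ ≠ 0) :
    ∃ ψ : E d → ℝ, ContDiff ℝ ∞ ψ ∧ (∀ x, |ψ x| ≤ M) ∧
      eLpNorm (fun x => ψ x - Φ x) 2 (volume.restrict K) ≤ δ ∧
      eLpNorm (fun x => gradient ψ x - b x) 2 (volume.restrict K) ≤ δ := by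
  have hf : MemLp (U.indicator Φ) 2 volume := (memLp_indicator_iff_restrict hU.measurableSet).2 hΦ2
  have hg : MemLp (U.indicator b) 2 volume := (memLp_indicator_iff_restrict hU.measurableSet).2 hb2
  obtain ⟨r₁, hr₁, h₁⟩ := exists_forall_eLpNorm_normed_convolution_sub_le hf hδ
  obtain ⟨r₂, hr₂, h₂⟩ := exists_forall_eLpNorm_normed_convolution_sub_le hg hδ
  obtain ⟨r₃, hr₃, h₃⟩ := hK.exists_cthickening_subset_open hU hKU
  have hr : 0 < min r₁ (min r₂ r₃) := by positivity
  let η : ContDiffBump (0 : E d) := ⟨min r₁ (min r₂ r₃) / 2, min r₁ (min r₂ r₃), by positivity,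
    by linarith⟩
  have hη1 : η.rOut ≤ r₁ := min_le_left _ _
  have hη2 : η.rOut ≤ r₂ := (min_le_right _ _).trans (min_le_left _ _)
  have hη3 : η.rOut ≤ r₃ := (min_le_right _ _).trans (min_le_right _ _)
  have hfl : LocallyIntegrable (U.indicator Φ) := hf.locallyIntegrable (by norm_num)
  have hgl : LocallyIntegrable (U.indicator b) := hg.locallyIntegrable (by norm_num)
  have hηd : ContDiff ℝ (⊤ : ℕ∞) (η.normed (volume : Measure (E d))) := η.contDiff_normed
  refine ⟨η.normed volume ⋆[ContinuousLinearMap.lsmul ℝ ℝ, volume] U.indicator Φ,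
    η.hasCompactSupport_normed.contDiff_convolution_left _ hηd hfl, fun x => ?_, ?_, ?_⟩
  · have hbd : ∀ᵐ y : E d, |U.indicator Φ y| ≤ M := by
      rw [ae_restrict_iff' hU.measurableSet] at hΦM
      filter_upwards [hΦM] with y hy
      by_cases hyU : y ∈ U
      · simpa [hyU] using hy hyU
      · simpa [hyU] using hM
    rw [convolution_eq_swap, ← Real.norm_eq_abs]
    have hi : Integrable (fun y => η.normed volume (x - y)) volume :=
      (η.integrable_normed (μ := volume)).comp_sub_left x
    calc _ ≤ ∫ y, η.normed volume (x - y) * M := by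
          refine norm_integral_le_of_norm_le (hi.mul_const M) ?_
          filter_upwards [hbd] with y hy
          rw [ContinuousLinearMap.lsmul_apply, norm_smul,
            Real.norm_of_nonneg (η.nonneg_normed _)]
          exact mul_le_mul_of_nonneg_left hy (η.nonneg_normed _)
      _ = M := by
          rw [integral_mul_const, integral_sub_left_eq_self (η.normed volume) volume x,
            η.integral_normed, one_mul]
  · refine le_trans ?_ (h₁ η hη1)
    refine le_trans (le_of_eq (eLpNorm_congr_ae ?_)) (eLpNorm_restrict_le _ _ _ K)
    filter_upwards [ae_restrict_mem hK.measurableSet] with x hx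
    simp [hKU hx]
  · refine le_trans ?_ (h₂ η hη2)
    refine le_trans (le_of_eq (eLpNorm_congr_ae ?_)) (eLpNorm_restrict_le _ _ _ K)
    filter_upwards [ae_restrict_mem hK.measurableSet] with x hx
    have hxU : Metric.closedBall x η.rOut ⊆ U :=
      ((Metric.closedBall_subset_closedBall hη3).trans
        (Metric.closedBall_subset_cthickening hx r₃)).trans h₃
    rw [gradient_normed_convolution_eq hU hΦ hfl hgl η hxU]
    simp [hKU hx]

end SmoothApproximation

/-! ### Integration by parts against test functions, and the `arctan` weights -/

section TestFunctions

variable {d : ℕ} {U : Set (E d)}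

theorem IsTestFunction.memLp {φ : E d → ℝ} (hφ : IsTestFunction U φ) (μ : Measure (E d))
    [IsFiniteMeasureOnCompacts μ] (p : ℝ≥0∞) : MemLp φ p μ :=
  hφ.1.continuous.memLp_of_hasCompactSupport hφ.2.1

theorem IsTestFunction.memLp_gradient {φ : E d → ℝ} (hφ : IsTestFunction U φ)
    (μ : Measure (E d)) [IsFiniteMeasureOnCompacts μ] (p : ℝ≥0∞) : MemLp (gradient φ) p μ :=
  (continuous_gradient hφ.1).memLp_of_hasCompactSupport (hasCompactSupport_gradient hφ.2.1)

theorem IsTestFunction.mul {φ ψ : E d → ℝ} (hφ : IsTestFunction U φ) (hψ : ContDiff ℝ ∞ ψ) :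
    IsTestFunction U (fun x => φ x * ψ x) :=
  ⟨hφ.1.mul hψ, hφ.2.1.mul_right, (tsupport_mul_subset_left (f := φ) (g := ψ)).trans hφ.2.2⟩

theorem gradient_mul {φ ψ : E d → ℝ} (hφ : ContDiff ℝ ∞ φ) (hψ : ContDiff ℝ ∞ ψ) (x : E d) :
    gradient (fun x => φ x * ψ x) x = φ x • gradient ψ x + ψ x • gradient φ x := by
  have h := ((hφ.differentiable (by simp) x).hasFDerivAt.mul
    (hψ.differentiable (by simp) x).hasFDerivAt).fderiv
  change fderiv ℝ (fun x => φ x * ψ x) x = _ at h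
  simp [gradient, h]

theorem integral_inner_gradient_eq_neg {b : E d → E d} {h : Fin d → E d → ℝ}
    (hb : MemLp b 2 (volume.restrict U)) (hh : ∀ i, MemLp (h i) 2 (volume.restrict U))
    (hbh : ∀ i, HasWeakPartialDeriv U i (fun x => b x i) (h i)) {φ : E d → ℝ}
    (hφ : IsTestFunction U φ) :
    ∫ x in U, inner ℝ (b x) (gradient φ x) = - ∫ x in U, (∑ i, h i x) * φ x := by
  have hbi : ∀ i, MemLp (fun x => b x i) 2 (volume.restrict U) := fun i =>
    (EuclideanSpace.proj (𝕜 := ℝ) i : E d →L[ℝ] ℝ).comp_memLp' hb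
  have hgi : ∀ i, MemLp (fun x => gradient φ x i) 2 (volume.restrict U) := fun i =>
    (EuclideanSpace.proj (𝕜 := ℝ) i : E d →L[ℝ] ℝ).comp_memLp' (hφ.memLp_gradient _ 2)
  have h1 : ∀ x, inner ℝ (b x) (gradient φ x) = ∑ i, b x i * gradient φ x i := by
    intro x
    rw [PiLp.inner_apply]
    simp [mul_comm]
  have i1 : ∀ i, Integrable (fun x => b x i * gradient φ x i) (volume.restrict U) :=
    fun i => (hbi i).integrable_mul (hgi i)
  have i2 : ∀ i, Integrable (fun x => h i x * φ x) (volume.restrict U) :=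
    fun i => (hh i).integrable_mul (hφ.memLp _ 2)
  simp_rw [h1, Finset.sum_mul]
  rw [integral_finsetSum _ fun i _ => i1 i, integral_finsetSum _ fun i _ => i2 i, ← Finset.sum_neg_distrib]
  refine Finset.sum_congr rfl fun i _ => ?_
  simp_rw [gradient_apply_eq_fderiv]
  exact (hbh i).2.2 φ hφ

/-- This is the divergence identity tested with `ρ φ`, which is not smooth: test with `r n * φ` and
pass to the limit. The right side contains no derivative of `φ`, so it survives limits of merely
bounded `φ`. -/
theorem integral_mul_inner_gradient_eq_neg {ρ : E d → ℝ} {gρ b : E d → E d}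
    {h : E d → ℝ} {r : ℕ → E d → ℝ}
    (hρ : MemLp ρ 2 (volume.restrict U)) (hgρ : MemLp gρ 2 (volume.restrict U))
    (hr : ∀ n, IsTestFunction U (r n))
    (hrρ : Tendsto (fun n => eLpNorm (fun x => r n x - ρ x) 2 (volume.restrict U)) atTop (𝓝 0))
    (hrg : Tendsto (fun n => eLpNorm (fun x => gradient (r n) x - gρ x) 2 (volume.restrict U))
      atTop (𝓝 0))
    (hb : MemLp b 2 (volume.restrict U)) (hh : MemLp h 2 (volume.restrict U))
    (hbh : ∀ φ, IsTestFunction U φ →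
      ∫ x in U, inner ℝ (b x) (gradient φ x) = - ∫ x in U, h x * φ x)
    {φ : E d → ℝ} (hφ : IsTestFunction U φ) :
    ∫ x in U, ρ x * inner ℝ (b x) (gradient φ x) =
      - (∫ x in U, φ x * inner ℝ (b x) (gρ x)) - ∫ x in U, φ x * (h x * ρ x) := by
  obtain ⟨C, hC⟩ := (continuous_gradient hφ.1).bounded_above_of_compact_support
    (hasCompactSupport_gradient hφ.2.1)
  obtain ⟨C', hC'⟩ := hφ.1.continuous.bounded_above_of_compact_support hφ.2.1
  have hq : MemLp (fun x => (inner ℝ (b x) (gradient φ x) : ℝ)) 2 (volume.restrict U) := by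
    refine hb.of_le_mul (c := C)
      (hb.1.inner (continuous_gradient hφ.1).aestronglyMeasurable)
      (Eventually.of_forall fun x => ?_)
    refine (norm_inner_le_norm (𝕜 := ℝ) _ _).trans ?_
    rw [mul_comm]
    exact mul_le_mul_of_nonneg_right (hC x) (norm_nonneg _)
  have hφm : AEStronglyMeasurable φ (volume.restrict U) := hφ.1.continuous.aestronglyMeasurable
  have hφb : ∀ᵐ x ∂volume.restrict U, |φ x| ≤ C' := Eventually.of_forall hC'
  -- Here the fixed `L²` factor is the scalar `b·∇φ`, with `∇φ` bounded.
  have l1 := tendsto_integral_mul_inner (βs := fun _ _ => 1) (β := fun _ => 1) (M := 1) hq hρ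
    (fun n => (hr n).memLp _ 2) hrρ (fun _ => aestronglyMeasurable_const)
    (fun _ => by simp) (by simp)
  have l2 := tendsto_integral_mul_inner (βs := fun _ => φ) (β := φ) (M := C') hb hgρ
    (fun n => (hr n).memLp_gradient _ 2) hrg (fun _ => hφm) (fun _ => hφb) (by simp)
  have l3 := tendsto_integral_mul_inner (βs := fun _ => φ) (β := φ) (M := C') hh hρ
    (fun n => (hr n).memLp _ 2) hrρ (fun _ => hφm) (fun _ => hφb) (by simp)
  have key : ∀ n, (∫ x in U, 1 * inner ℝ (inner ℝ (b x) (gradient φ x) : ℝ) (r n x)) +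
      (∫ x in U, φ x * inner ℝ (b x) (gradient (r n) x)) =
      - ∫ x in U, φ x * inner ℝ (h x) (r n x) := by
    intro n
    have := hbh _ ((hr n).mul hφ.1)
    simp_rw [gradient_mul (hr n).1 hφ.1, inner_add_right, inner_smul_right] at this
    rw [integral_add] at this
    · convert this using 4
      · simp
      · simp; ring
    · exact ((hr n).memLp _ 2).integrable_mul hq
    · exact (integrable_inner_of_memLp hb ((hr n).memLp_gradient _ 2)).bdd_mul hφm hφb
  have := tendsto_nhds_unique (l1.add l2) (l3.neg.congr fun n => (key n).symm)
  have e1 : ∫ x in U, 1 * inner ℝ (inner ℝ (b x) (gradient φ x) : ℝ) (ρ x) =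
      ∫ x in U, ρ x * inner ℝ (b x) (gradient φ x) := by simp
  have e3 : ∫ x in U, φ x * inner ℝ (h x) (ρ x) = ∫ x in U, φ x * (h x * ρ x) := by
    simp [mul_comm]
  rw [e1, e3] at this
  linarith

/-- The derivative of `arctan (s * exp t)` in `s`. -/
noncomputable def arctanWeight (s t : ℝ) : ℝ := Real.exp t / (1 + (s * Real.exp t) ^ 2)

theorem arctanWeight_pos (s t : ℝ) : 0 < arctanWeight s t := by
  unfold arctanWeight; positivity

theorem continuous_arctanWeight : Continuous fun z : ℝ × ℝ => arctanWeight z.1 z.2 := by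
  unfold arctanWeight
  refine Continuous.div (by fun_prop) (by fun_prop) fun z => by positivity

theorem abs_arctanWeight_le {t M : ℝ} (s : ℝ) (ht : |t| ≤ M) :
    |arctanWeight s t| ≤ Real.exp M := by
  rw [abs_of_pos (arctanWeight_pos s t)]
  unfold arctanWeight
  refine (div_le_self (Real.exp_pos t).le ?_).trans (Real.exp_le_exp.2 ((le_abs_self t).trans ht))
  nlinarith [sq_nonneg (s * Real.exp t)]

/-- With `y = s exp t` the quantity is `|y| / (1 + y²)`, whatever the size of `t`. -/
theorem abs_mul_arctanWeight_le (s t : ℝ) : |s * arctanWeight s t| ≤ 1 := by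
  unfold arctanWeight
  rw [mul_div_assoc', abs_div, abs_of_pos (by positivity : 0 < 1 + (s * Real.exp t) ^ 2),
    div_le_one (by positivity)]
  nlinarith [sq_nonneg (|s * Real.exp t| - 1), sq_abs (s * Real.exp t),
    abs_nonneg (s * Real.exp t)]

/-- With `y = s exp t` the quantity is `exp (-t) * y² / (1 + y²)`. This quadratic decay is what
makes the term `ρ² |b|²` of the energy integrable. -/
theorem abs_sq_mul_arctanWeight_le {t M : ℝ} (s : ℝ) (ht : |t| ≤ M) :
    |s ^ 2 * arctanWeight s t| ≤ Real.exp M := by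
  rw [abs_of_nonneg (mul_nonneg (sq_nonneg s) (arctanWeight_pos s t).le)]
  have h1 : Real.exp (-t) ≤ Real.exp M := Real.exp_le_exp.2 ((neg_le_abs t).trans ht)
  refine le_trans ?_ h1
  unfold arctanWeight
  rw [mul_div_assoc', div_le_iff₀ (by positivity)]
  have h2 : Real.exp (-t) * Real.exp t = 1 := by rw [← Real.exp_add]; simp
  have h3 : Real.exp (-t) * (1 + (s * Real.exp t) ^ 2) =
      Real.exp (-t) + s ^ 2 * Real.exp t * (Real.exp (-t) * Real.exp t) := by ring
  rw [h3, h2]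
  linarith [Real.exp_pos (-t)]

theorem abs_arctan_le (x : ℝ) : |Real.arctan x| ≤ Real.pi / 2 :=
  abs_le.2 ⟨(Real.neg_pi_div_two_lt_arctan x).le, (Real.arctan_lt_pi_div_two x).le⟩

theorem gradient_arctan_mul_exp {r p : E d → ℝ} (hr : ContDiff ℝ ∞ r) (hp : ContDiff ℝ ∞ p)
    (x : E d) :
    gradient (fun x => Real.arctan (r x * Real.exp (p x))) x =
      arctanWeight (r x) (p x) • gradient r x +
        (r x * arctanWeight (r x) (p x)) • gradient p x := by
  have h := ((hr.differentiable (by simp) x).hasFDerivAt.mul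
    (hp.differentiable (by simp) x).hasFDerivAt.exp).arctan.fderiv
  change fderiv ℝ (fun x => Real.arctan (r x * Real.exp (p x))) x = _ at h
  simp only [gradient, h, Pi.mul_apply, arctanWeight, map_add, map_smulₛₗ, smul_add, smul_smul, conj_trivial]
  rw [add_comm]
  congr 2 <;> field_simp

theorem IsTestFunction.arctan_mul_exp {r p : E d → ℝ} (hr : IsTestFunction U r)
    (hp : ContDiff ℝ ∞ p) : IsTestFunction U (fun x => Real.arctan (r x * Real.exp (p x))) := by
  have h := hr.mul hp.exp
  have hs : tsupport (fun x => Real.arctan (r x * Real.exp (p x))) ⊆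
      tsupport fun x => r x * Real.exp (p x) := by
    refine closure_mono fun x hx => ?_
    contrapose! hx
    simp only [Function.mem_support, not_not] at hx ⊢
    simp [hx]
  exact ⟨h.1.arctan, h.2.1.of_isClosed_subset (isClosed_tsupport _) hs, hs.trans h.2.2⟩

/-- Integrate `v² = v² ∂ᵢxᵢ` by parts. On a bounded set this plays the role of the Poincaré
inequality, and as an identity it passes directly to the limit. -/
theorem integral_sq_eq_neg_integral_coord {v : E d → ℝ} (hv : IsTestFunction U v) (i : Fin d) :
    ∫ x in U, v x ^ 2 =
      -2 * ∫ x in U, v x * inner ℝ (x i • EuclideanSpace.single i (1 : ℝ)) (gradient v x) := by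
  have hvU : ∀ x, x ∉ U → v x = 0 := fun x hx =>
    image_eq_zero_of_notMem_tsupport fun h => hx (hv.2.2 h)
  rw [setIntegral_eq_integral_of_forall_compl_eq_zero fun x hx => by simp [hvU x hx],
    setIntegral_eq_integral_of_forall_compl_eq_zero fun x hx => by simp [hvU x hx]]
  have hv2 : IsTestFunction U (fun x => v x * v x) := hv.mul hv.1
  set e : E d := EuclideanSpace.single i 1 with he
  have hc : Continuous fun x : E d => x i := by fun_prop
  have hfd : Continuous fun x => fderiv ℝ (fun x => v x * v x) x e :=
    (hv2.1.continuous_fderiv (by simp)).clm_apply continuous_const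
  have hpd : ∀ x : E d, fderiv ℝ (fun x : E d => x i) x e = 1 := by
    intro x
    have : HasFDerivAt (fun x : E d => x i) (EuclideanSpace.proj (𝕜 := ℝ) i : E d →L[ℝ] ℝ) x :=
      (EuclideanSpace.proj (𝕜 := ℝ) i : E d →L[ℝ] ℝ).hasFDerivAt
    rw [this.fderiv]
    simp [he]
  have ibp := integral_mul_fderiv_eq_neg_fderiv_mul_of_integrable (μ := (volume : Measure (E d)))
    (f := fun x : E d => x i) (g := fun x => v x * v x) (v := e)
    (by simp_rw [hpd, one_mul]; exact hv2.1.continuous.integrable_of_hasCompactSupport hv2.2.1)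
    ((hc.mul hfd).integrable_of_hasCompactSupport (hv2.2.1.fderiv_apply ℝ e).mul_left)
    ((hc.mul hv2.1.continuous).integrable_of_hasCompactSupport hv2.2.1.mul_left)
    (fun x _ => (EuclideanSpace.proj (𝕜 := ℝ) i : E d →L[ℝ] ℝ).differentiableAt)
    (fun x _ => hv2.1.differentiable (by simp) x)
  simp_rw [hpd, one_mul] at ibp
  rw [neg_mul, ← integral_const_mul, eq_comm, neg_eq_iff_eq_neg]
  simp_rw [sq]
  rw [← ibp]
  refine integral_congr_ae (Eventually.of_forall fun x => ?_)
  have h := ((hv.1.differentiable (by simp) x).hasFDerivAt.mul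
    (hv.1.differentiable (by simp) x).hasFDerivAt).fderiv
  change fderiv ℝ (fun x => v x * v x) x = _ at h
  have hin : (inner ℝ (x i • e) (gradient v x) : ℝ) = x i * fderiv ℝ v x e := by
    rw [real_inner_smul_left, inner_gradient_right]
    rfl
  simp only [h, hin, add_apply, smul_apply, smul_eq_mul]
  ring

end TestFunctions

/-! ### Uniqueness for the linear equation with a bounded potential -/

section Uniqueness

variable {d : ℕ} {U : Set (E d)}

theorem eLpNorm_piecewise_sub_eq {α F : Type*} [MeasurableSpace α] [NormedAddCommGroup F]
    {μ : Measure α} {U K : Set α} [DecidablePred (· ∈ K)] (hK : MeasurableSet K) (hKU : K ⊆ U)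
    (f g : α → F) (p : ℝ≥0∞) :
    eLpNorm (fun x => K.piecewise f g x - g x) p (μ.restrict U) =
      eLpNorm (fun x => f x - g x) p (μ.restrict K) := by
  have h : (fun x => K.piecewise f g x - g x) = K.indicator fun x => f x - g x := by
    funext x
    by_cases hx : x ∈ K <;> simp [hx]
  rw [h, eLpNorm_indicator_eq_eLpNorm_restrict hK, Measure.restrict_restrict hK,
    Set.inter_eq_left.2 hKU]

-- Take the mollification error on the support of `r n` to be `1 / (n + 1)`. Gluing `p n` on that
-- support to `Φ` off it gives convergence on all of `U`, although mollification is controlled only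
-- on compact subsets.
open Classical in
theorem exists_approximating_sequences (hU : IsOpen U) {ρ Φ : E d → ℝ} {gρ b : E d → E d} {M : ℝ}
    (hM : 0 ≤ M) (hρ : MemLp ρ 2 (volume.restrict U))
    {r : ℕ → E d → ℝ} (hr : ∀ n, IsTestFunction U (r n))
    (hrρ : Tendsto (fun n => eLpNorm (fun x => r n x - ρ x) 2 (volume.restrict U)) atTop (𝓝 0))
    (hrg : Tendsto (fun n => eLpNorm (fun x => gradient (r n) x - gρ x) 2 (volume.restrict U))
      atTop (𝓝 0))
    (hΦ : HasWeakGradient U Φ b) (hΦM : ∀ᵐ x ∂volume.restrict U, |Φ x| ≤ M)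
    (hΦ2 : MemLp Φ 2 (volume.restrict U)) (hb2 : MemLp b 2 (volume.restrict U)) :
    ∃ (s p : ℕ → E d → ℝ), (∀ n, IsTestFunction U (s n)) ∧
      Tendsto (fun n => eLpNorm (fun x => s n x - ρ x) 2 (volume.restrict U)) atTop (𝓝 0) ∧
      Tendsto (fun n => eLpNorm (fun x => gradient (s n) x - gρ x) 2 (volume.restrict U))
        atTop (𝓝 0) ∧
      (∀ᵐ x ∂volume.restrict U, Tendsto (fun n => s n x) atTop (𝓝 (ρ x))) ∧
      (∀ n, ContDiff ℝ ∞ (p n)) ∧ (∀ n x, |p n x| ≤ M) ∧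
      (∀ᵐ x ∂volume.restrict U,
        Tendsto (fun n => (tsupport (s n)).piecewise (p n) Φ x) atTop (𝓝 (Φ x))) ∧
      Tendsto (fun n => eLpNorm (fun x =>
        (tsupport (s n)).piecewise (gradient (p n)) b x - b x) 2 (volume.restrict U))
        atTop (𝓝 0) := by
  have hδ : ∀ n : ℕ, ((n : ℝ≥0∞) + 1)⁻¹ ≠ 0 := fun n => by
    simp [ENNReal.add_eq_top]
  have hδ0 : Tendsto (fun n : ℕ => ((n : ℝ≥0∞) + 1)⁻¹) atTop (𝓝 0) := by
    simpa using (tendsto_add_atTop_iff_nat 1).2 ENNReal.tendsto_inv_nat_nhds_zero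
  choose p hp hpM hpΦ hpb using fun n => exists_contDiff_approx_of_hasWeakGradient hU hM hΦ hΦM
    hΦ2 hb2 (hr n).2.1.isCompact (hr n).2.2 (hδ n)
  have hmeas : ∀ n, MeasurableSet (tsupport (r n)) := fun n => (isClosed_tsupport _).measurableSet
  have hP : Tendsto (fun n => eLpNorm (fun x => (tsupport (r n)).piecewise (p n) Φ x - Φ x) 2
      (volume.restrict U)) atTop (𝓝 0) := by
    refine tendsto_of_tendsto_of_tendsto_of_le_of_le tendsto_const_nhds hδ0 (fun _ => zero_le)
      fun n => ?_
    simp only [eLpNorm_piecewise_sub_eq (hmeas n) (hr n).2.2]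
    exact hpΦ n
  have hQ : Tendsto (fun n => eLpNorm (fun x =>
      (tsupport (r n)).piecewise (gradient (p n)) b x - b x) 2 (volume.restrict U))
      atTop (𝓝 0) := by
    refine tendsto_of_tendsto_of_tendsto_of_le_of_le tendsto_const_nhds hδ0 (fun _ => zero_le)
      fun n => ?_
    simp only [eLpNorm_piecewise_sub_eq (hmeas n) (hr n).2.2]
    exact hpb n
  have hPm : ∀ n, AEStronglyMeasurable ((tsupport (r n)).piecewise (p n) Φ)
      (volume.restrict U) := fun n =>
    AEStronglyMeasurable.piecewise (hmeas n) (hp n).continuous.aestronglyMeasurable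
      hΦ2.1.restrict
  -- Two successive subsequences give almost everywhere convergence of both sequences.
  obtain ⟨k, hk, hkρ⟩ := (tendstoInMeasure_of_tendsto_eLpNorm (by norm_num)
    (fun n => (hr n).1.continuous.aestronglyMeasurable) hρ.1 hrρ).exists_seq_tendsto_ae
  obtain ⟨l, hl, hlΦ⟩ := (tendstoInMeasure_of_tendsto_eLpNorm (by norm_num)
    (fun n => hPm (k n)) hΦ2.1 (hP.comp hk.tendsto_atTop)).exists_seq_tendsto_ae
  have hkl : Tendsto (fun n => k (l n)) atTop atTop := hk.tendsto_atTop.comp hl.tendsto_atTop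
  refine ⟨fun n => r (k (l n)), fun n => p (k (l n)), fun n => hr _, hrρ.comp hkl, hrg.comp hkl,
    ?_, fun n => hp _, fun n => hpM _, hlΦ, hQ.comp hkl⟩
  filter_upwards [hkρ] with x hx using hx.comp hl.tendsto_atTop

-- Off the support of `s` both `s` and its gradient vanish, so the value of the potential there is
-- irrelevant and may be taken to be `Φ`.
open Classical in
theorem gradient_arctan_mul_exp_piecewise {s p Φ : E d → ℝ} {b : E d → E d}
    (hs : IsTestFunction U s) (hp : ContDiff ℝ ∞ p) (x : E d) :
    gradient (fun x => Real.arctan (s x * Real.exp (p x))) x =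
      arctanWeight (s x) ((tsupport s).piecewise p Φ x) • gradient s x +
        (s x * arctanWeight (s x) ((tsupport s).piecewise p Φ x)) •
          (tsupport s).piecewise (gradient p) b x := by
  rw [gradient_arctan_mul_exp hs.1 hp]
  by_cases hx : x ∈ tsupport s
  · simp [hx]
  · have h1 : s x = 0 := image_eq_zero_of_notMem_tsupport hx
    have h2 : gradient s x = 0 :=
      image_eq_zero_of_notMem_tsupport fun h => hx (tsupport_gradient_subset s h)
    simp [h1, h2]

-- Testing the equation with `v n` and the divergence identity with `s n * v n` yields two limit
-- relations. Their sum eliminates the terms containing `h` and leaves the weighted square of the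
-- flux.
open Classical in
theorem ae_eq_zero_of_weak_solution (i₀ : Fin d) (hU : IsOpen U) (hUb : Bornology.IsBounded U)
    {ρ Φ h : E d → ℝ} {gρ b : E d → E d} {M : ℝ} (hM : 0 ≤ M)
    (hρ : MemLp ρ 2 (volume.restrict U)) (hgρ : MemLp gρ 2 (volume.restrict U))
    {r : ℕ → E d → ℝ} (hr : ∀ n, IsTestFunction U (r n))
    (hrρ : Tendsto (fun n => eLpNorm (fun x => r n x - ρ x) 2 (volume.restrict U)) atTop (𝓝 0))
    (hrg : Tendsto (fun n => eLpNorm (fun x => gradient (r n) x - gρ x) 2 (volume.restrict U))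
      atTop (𝓝 0))
    (hΦ : HasWeakGradient U Φ b) (hΦM : ∀ᵐ x ∂volume.restrict U, |Φ x| ≤ M)
    (hΦ2 : MemLp Φ 2 (volume.restrict U)) (hb : MemLp b 2 (volume.restrict U))
    (hh : MemLp h 2 (volume.restrict U))
    (hbh : ∀ φ, IsTestFunction U φ →
      ∫ x in U, inner ℝ (b x) (gradient φ x) = - ∫ x in U, h x * φ x)
    (heq : ∀ φ, IsTestFunction U φ →
      ∫ x in U, inner ℝ (gρ x + ρ x • b x) (gradient φ x) = 0) :
    ρ =ᵐ[volume.restrict U] fun _ => 0 := by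
  obtain ⟨s, p, hs, hsρ, hsg, hsa, hp, hpM, hPa, hQ⟩ :=
    exists_approximating_sequences hU hM hρ hr hrρ hrg hΦ hΦM hΦ2 hb
  set P : ℕ → E d → ℝ := fun n => (tsupport (s n)).piecewise (p n) Φ with hPdef
  set Q : ℕ → E d → E d := fun n => (tsupport (s n)).piecewise (gradient (p n)) b with hQdef
  set v : ℕ → E d → ℝ := fun n x => Real.arctan (s n x * Real.exp (p n x)) with hvdef
  have hv : ∀ n, IsTestFunction U (v n) := fun n => (hs n).arctan_mul_exp (hp n)
  have hvP : ∀ n x, v n x = Real.arctan (s n x * Real.exp (P n x)) := by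
    intro n x
    by_cases hx : x ∈ tsupport (s n)
    · simp [hvdef, hPdef, hx]
    · simp [hvdef, image_eq_zero_of_notMem_tsupport hx]
  have hgv : ∀ n x, gradient (v n) x = arctanWeight (s n x) (P n x) • gradient (s n) x +
      (s n x * arctanWeight (s n x) (P n x)) • Q n x := fun n x =>
    gradient_arctan_mul_exp_piecewise (hs n) (hp n) x
  have hmeas : ∀ n, MeasurableSet (tsupport (s n)) := fun n => (isClosed_tsupport _).measurableSet
  have hPm : ∀ n, AEStronglyMeasurable (P n) (volume.restrict U) := fun n =>
    AEStronglyMeasurable.piecewise (hmeas n) (hp n).continuous.aestronglyMeasurable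
      hΦ2.1.restrict
  have hPM : ∀ n, ∀ᵐ x ∂volume.restrict U, |P n x| ≤ M := by
    intro n
    filter_upwards [hΦM] with x hx
    by_cases hxs : x ∈ tsupport (s n)
    · simpa [hPdef, hxs] using hpM n x
    · simpa [hPdef, hxs] using hx
  have hsm : ∀ n, AEStronglyMeasurable (s n) (volume.restrict U) := fun n =>
    (hs n).1.continuous.aestronglyMeasurable
  have hQ2 : ∀ n, MemLp (Q n) 2 (volume.restrict U) := by
    intro n
    refine MemLp.piecewise (hmeas n) ?_ (hb.restrict _)
    rw [Measure.restrict_restrict (hmeas n), Set.inter_eq_left.2 (hs n).2.2]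
    have : IsFiniteMeasure (volume.restrict (tsupport (s n))) :=
      ⟨by simpa using (hs n).2.1.isCompact.measure_lt_top⟩
    obtain ⟨C, hC⟩ := (hs n).2.1.isCompact.exists_bound_of_continuousOn
      (continuous_gradient (hp n)).continuousOn
    exact MemLp.of_bound (continuous_gradient (hp n)).aestronglyMeasurable C
      (ae_restrict_of_forall_mem (hmeas n) hC)
  -- measurability, bounds and limits of the coefficients
  have hαm : ∀ n, AEStronglyMeasurable (fun x => arctanWeight (s n x) (P n x))
      (volume.restrict U) := fun n =>
    continuous_arctanWeight.comp_aestronglyMeasurable ((hsm n).prodMk (hPm n))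
  have hαM : ∀ n, ∀ᵐ x ∂volume.restrict U, |arctanWeight (s n x) (P n x)| ≤ Real.exp M :=
    fun n => (hPM n).mono fun x hx => abs_arctanWeight_le _ hx
  have hαa : ∀ᵐ x ∂volume.restrict U, Tendsto (fun n => arctanWeight (s n x) (P n x)) atTop
      (𝓝 (arctanWeight (ρ x) (Φ x))) := by
    filter_upwards [hsa, hPa] with x h1 h2
    exact (continuous_arctanWeight.tendsto (ρ x, Φ x)).comp (h1.prodMk_nhds h2)
  have hκm : ∀ n, AEStronglyMeasurable (fun x => s n x * arctanWeight (s n x) (P n x))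
      (volume.restrict U) := fun n => (hsm n).mul (hαm n)
  have hκM : ∀ n, ∀ᵐ x ∂volume.restrict U, |s n x * arctanWeight (s n x) (P n x)| ≤ 1 :=
    fun n => Eventually.of_forall fun x => abs_mul_arctanWeight_le _ _
  have hκa : ∀ᵐ x ∂volume.restrict U, Tendsto (fun n => s n x * arctanWeight (s n x) (P n x))
      atTop (𝓝 (ρ x * arctanWeight (ρ x) (Φ x))) := by
    filter_upwards [hsa, hαa] with x h1 h2 using h1.mul h2
  have hσm : ∀ n, AEStronglyMeasurable (fun x => s n x ^ 2 * arctanWeight (s n x) (P n x))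
      (volume.restrict U) := fun n => ((hsm n).pow 2).mul (hαm n)
  have hσM : ∀ n, ∀ᵐ x ∂volume.restrict U, |s n x ^ 2 * arctanWeight (s n x) (P n x)| ≤
      Real.exp M := fun n => (hPM n).mono fun x hx => abs_sq_mul_arctanWeight_le _ hx
  have hσa : ∀ᵐ x ∂volume.restrict U, Tendsto (fun n => s n x ^ 2 * arctanWeight (s n x) (P n x))
      atTop (𝓝 (ρ x ^ 2 * arctanWeight (ρ x) (Φ x))) := by
    filter_upwards [hsa, hαa] with x h1 h2 using (h1.pow 2).mul h2
  set w : E d → ℝ := fun x => Real.arctan (ρ x * Real.exp (Φ x)) with hwdef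
  have hvm : ∀ n, AEStronglyMeasurable (v n) (volume.restrict U) := fun n =>
    (hv n).1.continuous.aestronglyMeasurable
  have hvM : ∀ n, ∀ᵐ x ∂volume.restrict U, |v n x| ≤ Real.pi / 2 := fun n =>
    Eventually.of_forall fun x => abs_arctan_le _
  have hva : ∀ᵐ x ∂volume.restrict U, Tendsto (fun n => v n x) atTop (𝓝 (w x)) := by
    filter_upwards [hsa, hPa] with x h1 h2
    simp_rw [hvP]
    exact (Real.continuous_arctan.tendsto _).comp
      (h1.mul ((Real.continuous_exp.tendsto _).comp h2))
  have hs2 : ∀ n, MemLp (s n) 2 (volume.restrict U) := fun n => (hs n).memLp _ 2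
  have hgs2 : ∀ n, MemLp (gradient (s n)) 2 (volume.restrict U) := fun n =>
    (hs n).memLp_gradient _ 2
  have hc : ∀ f : E d → E d, Tendsto (fun _ : ℕ => eLpNorm (fun x => f x - f x) 2
      (volume.restrict U)) atTop (𝓝 0) := fun f => by simp
  have hint : ∀ {β : E d → ℝ} {C : ℝ} {q f : E d → E d},
      AEStronglyMeasurable β (volume.restrict U) → (∀ᵐ x ∂volume.restrict U, |β x| ≤ C) →
      MemLp q 2 (volume.restrict U) → MemLp f 2 (volume.restrict U) →
      Integrable (fun x => β x * inner ℝ (q x) (f x)) (volume.restrict U) :=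
    fun h1 h2 h3 h4 => (integrable_inner_of_memLp h3 h4).bdd_mul h1 h2
  -- the weak equation tested with `v n`
  have E1 : ∀ n, (∫ x in U, arctanWeight (s n x) (P n x) * inner ℝ (gρ x) (gradient (s n) x)) +
      (∫ x in U, (s n x * arctanWeight (s n x) (P n x)) * inner ℝ (gρ x) (Q n x)) =
      (∫ x in U, v n x * inner ℝ (b x) (gρ x)) + ∫ x in U, v n x * inner ℝ (h x) (ρ x) := by
    intro n
    have h1 := heq _ (hv n)
    have h2 := integral_mul_inner_gradient_eq_neg hρ hgρ hr hrρ hrg hb hh hbh (hv n)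
    obtain ⟨C, hC⟩ := (continuous_gradient (hv n).1).bounded_above_of_compact_support
      (hasCompactSupport_gradient (hv n).2.1)
    have hq : MemLp (fun x => (inner ℝ (b x) (gradient (v n) x) : ℝ)) 2 (volume.restrict U) := by
      refine hb.of_le_mul (c := C)
        (hb.1.inner (continuous_gradient (hv n).1).aestronglyMeasurable)
        (Eventually.of_forall fun x => ?_)
      refine (norm_inner_le_norm (𝕜 := ℝ) _ _).trans ?_
      rw [mul_comm]
      exact mul_le_mul_of_nonneg_right (hC x) (norm_nonneg _)
    simp_rw [inner_add_left, real_inner_smul_left] at h1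
    have iq : Integrable (fun x => ρ x * inner ℝ (b x) (gradient (v n) x))
      (volume.restrict U) := hρ.integrable_mul hq
    rw [integral_add (integrable_inner_of_memLp hgρ ((hv n).memLp_gradient _ 2)) iq, h2] at h1
    rw [← integral_add (hint (hαm n) (hαM n) hgρ (hgs2 n)) (hint (hκm n) (hκM n) hgρ (hQ2 n))]
    have h3 : ∫ x in U, (inner ℝ (gρ x) (gradient (v n) x) : ℝ) =
        ∫ x in U, (arctanWeight (s n x) (P n x) * inner ℝ (gρ x) (gradient (s n) x) +
          (s n x * arctanWeight (s n x) (P n x)) * inner ℝ (gρ x) (Q n x)) := by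
      refine integral_congr_ae (Eventually.of_forall fun x => ?_)
      simp only [hgv, inner_add_right, real_inner_smul_right]
    have h4 : ∫ x in U, v n x * inner ℝ (h x) (ρ x) = ∫ x in U, v n x * (h x * ρ x) := by
      simp [mul_comm]
    rw [← h3, h4]
    linarith
  have L1 := tendsto_nhds_unique
    (((tendsto_integral_mul_inner hgρ hgρ hgs2 hsg hαm hαM hαa).add
      (tendsto_integral_mul_inner hgρ hb hQ2 hQ hκm hκM hκa)).congr E1)
    ((tendsto_integral_mul_inner hb hgρ (fun _ => hgρ) (hc gρ) hvm hvM hva).add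
      (tendsto_integral_mul_inner hh hρ (fun _ => hρ) (by simp) hvm hvM hva))
  -- The divergence identity tested with `s n * v n`; differentiating `v n` produces the
  -- coefficients `s α` and `s² α`, where `α` is the `arctan` weight.
  have E2 : ∀ n, (∫ x in U, v n x * inner ℝ (b x) (gradient (s n) x)) +
      (∫ x in U, (s n x * arctanWeight (s n x) (P n x)) * inner ℝ (b x) (gradient (s n) x)) +
      (∫ x in U, (s n x ^ 2 * arctanWeight (s n x) (P n x)) * inner ℝ (b x) (Q n x)) =
      - ∫ x in U, v n x * inner ℝ (h x) (s n x) := by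
    intro n
    have h1 := hbh _ ((hs n).mul (hv n).1)
    have i1 := hint (hvm n) (hvM n) hb (hgs2 n)
    have i2 := hint (hκm n) (hκM n) hb (hgs2 n)
    have i3 := hint (hσm n) (hσM n) hb (hQ2 n)
    have i12 : Integrable (fun x => v n x * inner ℝ (b x) (gradient (s n) x) +
        (s n x * arctanWeight (s n x) (P n x)) * inner ℝ (b x) (gradient (s n) x))
        (volume.restrict U) := i1.add i2
    rw [← integral_add i1 i2, ← integral_add i12 i3]
    have h4 : ∫ x in U, v n x * inner ℝ (h x) (s n x) = ∫ x in U, h x * (s n x * v n x) := by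
      refine integral_congr_ae (Eventually.of_forall fun x => ?_)
      simp
      ring
    rw [h4, ← h1]
    refine integral_congr_ae (Eventually.of_forall fun x => ?_)
    simp only [gradient_mul (hs n).1 (hv n).1, hgv, inner_add_right, real_inner_smul_right]
    ring
  have L2 := tendsto_nhds_unique
    ((((tendsto_integral_mul_inner hb hgρ hgs2 hsg hvm hvM hva).add
      (tendsto_integral_mul_inner hb hgρ hgs2 hsg hκm hκM hκa)).add
      (tendsto_integral_mul_inner hb hb hQ2 hQ hσm hσM hσa)).congr E2)
    (tendsto_integral_mul_inner hh hρ hs2 hsρ hvm hvM hva).neg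
  -- the energy identity
  have hρm := hρ.1
  have hαm' : AEStronglyMeasurable (fun x => arctanWeight (ρ x) (Φ x)) (volume.restrict U) :=
    continuous_arctanWeight.comp_aestronglyMeasurable (hρm.prodMk hΦ2.1)
  have hκm' : AEStronglyMeasurable (fun x => ρ x * arctanWeight (ρ x) (Φ x))
      (volume.restrict U) := hρm.mul hαm'
  have hαM' : ∀ᵐ x ∂volume.restrict U, |arctanWeight (ρ x) (Φ x)| ≤ Real.exp M :=
    hΦM.mono fun x hx => abs_arctanWeight_le _ hx
  have hκM' : ∀ᵐ x ∂volume.restrict U, |ρ x * arctanWeight (ρ x) (Φ x)| ≤ 1 :=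
    Eventually.of_forall fun x => abs_mul_arctanWeight_le _ _
  have hσM' : ∀ᵐ x ∂volume.restrict U, |ρ x ^ 2 * arctanWeight (ρ x) (Φ x)| ≤ Real.exp M :=
    hΦM.mono fun x hx => abs_sq_mul_arctanWeight_le _ hx
  have j1 := hint hαm' hαM' hgρ hgρ
  have j2 := hint hκm' hκM' hgρ hb
  have j3 := hint hκm' hκM' hb hgρ
  have j4 := hint (β := fun x => ρ x ^ 2 * arctanWeight (ρ x) (Φ x))
    ((hρm.pow 2).mul hαm') hσM' hb hb
  have j12 : Integrable (fun x => arctanWeight (ρ x) (Φ x) * inner ℝ (gρ x) (gρ x) +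
      ρ x * arctanWeight (ρ x) (Φ x) * inner ℝ (gρ x) (b x)) (volume.restrict U) := j1.add j2
  have j123 : Integrable (fun x => arctanWeight (ρ x) (Φ x) * inner ℝ (gρ x) (gρ x) +
      ρ x * arctanWeight (ρ x) (Φ x) * inner ℝ (gρ x) (b x) +
      ρ x * arctanWeight (ρ x) (Φ x) * inner ℝ (b x) (gρ x)) (volume.restrict U) := j12.add j3
  have henergy : ∀ x, arctanWeight (ρ x) (Φ x) * inner ℝ (gρ x) (gρ x) +
      ρ x * arctanWeight (ρ x) (Φ x) * inner ℝ (gρ x) (b x) +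
      ρ x * arctanWeight (ρ x) (Φ x) * inner ℝ (b x) (gρ x) +
      ρ x ^ 2 * arctanWeight (ρ x) (Φ x) * inner ℝ (b x) (b x) =
      arctanWeight (ρ x) (Φ x) * ‖gρ x + ρ x • b x‖ ^ 2 := by
    intro x
    rw [← real_inner_self_eq_norm_sq]
    simp only [inner_add_left, inner_add_right, real_inner_smul_left, real_inner_smul_right]
    ring
  have hflux : ∀ᵐ x ∂volume.restrict U, gρ x + ρ x • b x = 0 := by
    have hI : ∫ x in U, arctanWeight (ρ x) (Φ x) * ‖gρ x + ρ x • b x‖ ^ 2 = 0 := by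
      simp_rw [← henergy]
      rw [integral_add j123 j4, integral_add j12 j3, integral_add j1 j2]
      -- Adding `L1` and `L2` cancels `∫ w b·gρ` and `∫ w h ρ`.
      linarith
    have hIi : Integrable (fun x => arctanWeight (ρ x) (Φ x) * ‖gρ x + ρ x • b x‖ ^ 2)
        (volume.restrict U) := by
      simp_rw [← henergy]
      exact j123.add j4
    have := (integral_eq_zero_iff_of_nonneg
      (fun x => mul_nonneg (arctanWeight_pos _ _).le (sq_nonneg _)) hIi).1 hI
    filter_upwards [this] with x hx
    have hx' : arctanWeight (ρ x) (Φ x) * ‖gρ x + ρ x • b x‖ ^ 2 = 0 := hx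
    simpa [(arctanWeight_pos _ _).ne'] using hx'
  -- a function with vanishing gradient and zero boundary values vanishes
  have : IsFiniteMeasure (volume.restrict U) := ⟨by simpa using hUb.measure_lt_top⟩
  have hq : MemLp (fun x : E d => x i₀ • (EuclideanSpace.single i₀ (1 : ℝ) : E d)) 2
      (volume.restrict U) := by
    obtain ⟨R, hR⟩ := hUb.exists_norm_le
    refine MemLp.of_bound (Continuous.aestronglyMeasurable (by fun_prop)) R
      (ae_restrict_of_forall_mem hU.measurableSet fun x hx => ?_)
    rw [norm_smul]
    simpa using (PiLp.norm_apply_le x i₀).trans (hR x hx)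
  set q : E d → E d := fun x => x i₀ • (EuclideanSpace.single i₀ (1 : ℝ) : E d) with hqdef
  have hvαM : ∀ n, ∀ᵐ x ∂volume.restrict U, |v n x * arctanWeight (s n x) (P n x)| ≤
      Real.pi / 2 * Real.exp M := by
    intro n
    filter_upwards [hvM n, hαM n] with x h1 h2
    rw [abs_mul]
    exact mul_le_mul h1 h2 (abs_nonneg _) (by positivity)
  have hvκM : ∀ n, ∀ᵐ x ∂volume.restrict U, |v n x * (s n x * arctanWeight (s n x) (P n x))| ≤
      Real.pi / 2 * 1 := by
    intro n
    filter_upwards [hvM n, hκM n] with x h1 h2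
    rw [abs_mul]
    exact mul_le_mul h1 h2 (abs_nonneg _) (by positivity)
  -- The factor `⟨1, 1⟩` puts the left side in the form required by the limit lemma.
  have E3 : ∀ n, ∫ x in U, v n x ^ 2 * inner ℝ (1 : ℝ) (1 : ℝ) = -2 *
      ((∫ x in U, (v n x * arctanWeight (s n x) (P n x)) * inner ℝ (q x) (gradient (s n) x)) +
      ∫ x in U, (v n x * (s n x * arctanWeight (s n x) (P n x))) * inner ℝ (q x) (Q n x)) := by
    intro n
    rw [← integral_add
      (hint (β := fun x => v n x * arctanWeight (s n x) (P n x))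
        ((hvm n).mul (hαm n)) (hvαM n) hq (hgs2 n))
      (hint (β := fun x => v n x * (s n x * arctanWeight (s n x) (P n x))) ((hvm n).mul (hκm n)) (hvκM n) hq (hQ2 n))]
    have := integral_sq_eq_neg_integral_coord (hv n) i₀
    simp only [inner_self_eq_norm_sq_to_K, norm_one, RCLike.ofReal_one, one_pow, mul_one]
    rw [this]
    congr 1
    refine integral_congr_ae (Eventually.of_forall fun x => ?_)
    simp only [hgv, inner_add_right, real_inner_smul_right, hqdef]
    ring
  have hone : MemLp (fun _ : E d => (1 : ℝ)) 2 (volume.restrict U) := memLp_const 1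
  have L3 := tendsto_nhds_unique
    ((tendsto_integral_mul_inner (βs := fun n x => v n x ^ 2) (β := fun x => w x ^ 2)
      (M := (Real.pi / 2) ^ 2) hone hone (fun _ => hone) (by simp) (fun n => (hvm n).pow 2)
      (fun n => (hvM n).mono fun x hx => by
        rw [abs_pow]; exact pow_le_pow_left₀ (abs_nonneg _) hx 2)
      (hva.mono fun x hx => hx.pow 2)).congr E3)
    (((tendsto_integral_mul_inner hq hgρ hgs2 hsg (fun n => (hvm n).mul (hαm n)) hvαM
      (by filter_upwards [hva, hαa] with x h1 h2 using h1.mul h2)).add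
      (tendsto_integral_mul_inner hq hb hQ2 hQ (fun n => (hvm n).mul (hκm n)) hvκM
      (by filter_upwards [hva, hκa] with x h1 h2 using h1.mul h2))).const_mul (-2))
  have hwm : AEStronglyMeasurable w (volume.restrict U) :=
    aestronglyMeasurable_of_tendsto_ae atTop hvm hva
  have hwM : ∀ x, |w x| ≤ Real.pi / 2 := fun x => abs_arctan_le _
  have hw0 : ∫ x in U, w x ^ 2 = 0 := by
    have h1 : ∫ x in U, w x ^ 2 * inner ℝ (1 : ℝ) (1 : ℝ) = ∫ x in U, w x ^ 2 := by simp
    rw [← h1, L3, ← integral_add]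
    -- Since `gρ = -ρ b`, the two integrands cancel pointwise.
    · rw [integral_eq_zero_of_ae, mul_zero]
      filter_upwards [hflux] with x hx
      have h2 : gρ x = - (ρ x • b x) := eq_neg_of_add_eq_zero_left hx
      simp only [h2, inner_neg_right, real_inner_smul_right, Pi.zero_apply]
      ring
    · refine hint (C := Real.pi / 2 * Real.exp M) (hwm.mul hαm') ?_ hq hgρ
      filter_upwards [hαM'] with x hx
      rw [abs_mul]
      exact mul_le_mul (hwM x) hx (abs_nonneg _) (by positivity)
    · refine hint (C := Real.pi / 2 * 1) (hwm.mul hκm') ?_ hq hb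
      filter_upwards [hκM'] with x hx
      rw [abs_mul]
      exact mul_le_mul (hwM x) hx (abs_nonneg _) (by positivity)
  have hwi : Integrable (fun x => w x ^ 2) (volume.restrict U) :=
    (MemLp.of_bound hwm (Real.pi / 2) (Eventually.of_forall hwM)).integrable_sq
  filter_upwards [(integral_eq_zero_iff_of_nonneg (fun x => sq_nonneg _) hwi).1 hw0] with x hx
  have hx' : w x ^ 2 = 0 := hx
  simpa [hwdef] using hx'

end Uniqueness

/-! ### Convolution over `U` and uniqueness of weak derivatives -/

section ConvolutionOn

variable {d : ℕ} {U : Set (E d)}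

theorem quasiMeasurePreserving_sub_restrict {x : E d} (hx : x ∈ U) :
    Measure.QuasiMeasurePreserving (fun y => x - y) (volume.restrict U)
      (volume.restrict (U - U)) :=
  (Measure.measurePreserving_sub_left volume x).quasiMeasurePreserving.restrict
    fun _ hy => Set.sub_mem_sub hx hy

/-- For `x ∈ U`, the measure-preserving map `y ↦ x - y` sends `U` into `U - U`. The bound is uniform
in `x`, hence so is the bound on the convolution. -/
theorem eLpNorm_comp_sub_le {F : Type*} [NormedAddCommGroup F] {f : E d → F}
    {x : E d} (hx : x ∈ U) (p : ℝ≥0∞) :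
    eLpNorm (fun y => f (x - y)) p (volume.restrict U) ≤ eLpNorm f p (volume.restrict (U - U)) := by
  have hmp := (Measure.measurePreserving_sub_left (volume : Measure (E d)) x)
  have he : MeasurableEmbedding (fun y : E d => x - y) :=
    (Homeomorph.subLeft x).measurableEmbedding
  have hsub : U ⊆ (fun y => x - y) ⁻¹' (U - U) := fun y hy => Set.sub_mem_sub hx hy
  calc _ ≤ eLpNorm (f ∘ fun y => x - y) p (volume.restrict ((fun y => x - y) ⁻¹' (U - U))) :=
        eLpNorm_mono_measure _ (Measure.restrict_mono hsub le_rfl)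
    _ = eLpNorm f p (volume.restrict (U - U)) := by
        have hr := hmp.restrict_preimage_emb he (U - U)
        rw [← hr.map_eq, he.eLpNorm_map_measure]

theorem memLp_comp_sub {F : Type*} [NormedAddCommGroup F] {f : E d → F}
    {p : ℝ≥0∞} (hf : MemLp f p (volume.restrict (U - U))) {x : E d} (hx : x ∈ U) :
    MemLp (fun y => f (x - y)) p (volume.restrict U) :=
  ⟨hf.1.comp_quasiMeasurePreserving (quasiMeasurePreserving_sub_restrict hx),
    (eLpNorm_comp_sub_le hx p).trans_lt hf.2⟩

theorem integrable_mul_comp_sub {ρ f : E d → ℝ} (hρ : MemLp ρ 2 (volume.restrict U)) (hf : MemLp f 2 (volume.restrict (U - U))) {x : E d}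
    (hx : x ∈ U) : Integrable (fun y => ρ y * f (x - y)) (volume.restrict U) :=
  hρ.integrable_mul (memLp_comp_sub hf hx)

theorem integral_norm_mul_comp_sub_le {ρ f : E d → ℝ}
    (hρ : MemLp ρ 2 (volume.restrict U)) (hf : MemLp f 2 (volume.restrict (U - U))) {x : E d}
    (hx : x ∈ U) :
    ∫ y in U, ‖ρ y * f (x - y)‖ ≤
      (eLpNorm ρ 2 (volume.restrict U) * eLpNorm f 2 (volume.restrict (U - U))).toReal := by
  rw [integral_norm_eq_lintegral_enorm (integrable_mul_comp_sub hρ hf hx).1,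
    ← eLpNorm_one_eq_lintegral_enorm]
  refine ENNReal.toReal_mono (ENNReal.mul_ne_top hρ.2.ne hf.2.ne) ?_
  refine le_trans ?_ (mul_le_mul_right (eLpNorm_comp_sub_le hx 2) _)
  have := eLpNorm_le_eLpNorm_mul_eLpNorm_of_nnnorm (p := 2) (q := 2) (r := 1)
    (μ := volume.restrict U) hρ.1 (memLp_comp_sub hf hx).1 (fun a b => a * b) 1
    (Eventually.of_forall fun x => by rw [one_mul, nnnorm_mul])
  simpa using this

theorem aestronglyMeasurable_mul_comp_sub_prod {ρ f : E d → ℝ}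
    (hρ : AEStronglyMeasurable ρ (volume.restrict U))
    (hf : AEStronglyMeasurable f (volume.restrict (U - U))) :
    AEStronglyMeasurable (fun z : E d × E d => ρ z.2 * f (z.1 - z.2))
      ((volume.restrict U).prod (volume.restrict U)) := by
  refine hρ.comp_snd.mul (hf.comp_quasiMeasurePreserving ?_)
  rw [Measure.prod_restrict]
  exact (quasiMeasurePreserving_sub_of_right_invariant (volume : Measure (E d)) volume).restrict
    fun z hz => Set.sub_mem_sub hz.1 hz.2

/-- The convolution `∫_U ρ(y) f(x - y) dy` of a scalar function `f` with a density `ρ` on `U`. -/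
noncomputable def scalarConvOn (U : Set (E d)) (f ρ : E d → ℝ) (x : E d) : ℝ :=
  ∫ y in U, ρ y * f (x - y)

theorem abs_scalarConvOn_le {ρ f : E d → ℝ}
    (hρ : MemLp ρ 2 (volume.restrict U)) (hf : MemLp f 2 (volume.restrict (U - U))) {x : E d}
    (hx : x ∈ U) :
    |scalarConvOn U f ρ x| ≤
      (eLpNorm ρ 2 (volume.restrict U) * eLpNorm f 2 (volume.restrict (U - U))).toReal :=
  (norm_integral_le_integral_norm _).trans (integral_norm_mul_comp_sub_le hρ hf hx)

theorem memLp_scalarConvOn (hU : IsOpen U) (hUb : Bornology.IsBounded U) {ρ f : E d → ℝ}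
    (hρ : MemLp ρ 2 (volume.restrict U)) (hf : MemLp f 2 (volume.restrict (U - U))) (p : ℝ≥0∞) :
    MemLp (scalarConvOn U f ρ) p (volume.restrict U) := by
  have : IsFiniteMeasure (volume.restrict U) := ⟨by simpa using hUb.measure_lt_top⟩
  exact MemLp.of_bound (aestronglyMeasurable_mul_comp_sub_prod hρ.1 hf.1).integral_prod_right' _
    (ae_restrict_of_forall_mem hU.measurableSet fun x hx => abs_scalarConvOn_le hρ hf hx)

/-- Fubini: the uniform Cauchy–Schwarz bound on the inner integrals and the finite measure of `U`
make the kernel integrable on the product. -/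
theorem integral_scalarConvOn_mul (hU : IsOpen U) (hUb : Bornology.IsBounded U) {ρ f ψ : E d → ℝ}
    (hρ : MemLp ρ 2 (volume.restrict U)) (hf : MemLp f 2 (volume.restrict (U - U)))
    (hψ : Continuous ψ) (hψc : HasCompactSupport ψ) :
    ∫ x in U, scalarConvOn U f ρ x * ψ x = ∫ y in U, ρ y * ∫ x in U, f (x - y) * ψ x := by
  have hfin : IsFiniteMeasure (volume.restrict U) := ⟨by simpa using hUb.measure_lt_top⟩
  obtain ⟨C, hC⟩ := hψ.bounded_above_of_compact_support hψc
  have hm := aestronglyMeasurable_mul_comp_sub_prod hρ.1 hf.1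
  have hi : Integrable (fun z : E d × E d => ρ z.2 * f (z.1 - z.2))
      ((volume.restrict U).prod (volume.restrict U)) := by
    rw [integrable_prod_iff hm]
    refine ⟨ae_restrict_of_forall_mem hU.measurableSet fun x hx =>
      integrable_mul_comp_sub hρ hf hx, ?_⟩
    refine Integrable.of_bound hm.norm.integral_prod_right'
      (eLpNorm ρ 2 (volume.restrict U) * eLpNorm f 2 (volume.restrict (U - U))).toReal
      (ae_restrict_of_forall_mem hU.measurableSet fun x hx => ?_)
    rw [Real.norm_of_nonneg (integral_nonneg fun _ => norm_nonneg _)]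
    exact integral_norm_mul_comp_sub_le hρ hf hx
  have hiψ : Integrable (Function.uncurry fun x y : E d => ψ x * (ρ y * f (x - y)))
      ((volume.restrict U).prod (volume.restrict U)) :=
    hi.bdd_mul (c := C) (hψ.comp continuous_fst).aestronglyMeasurable
      (Eventually.of_forall fun z => hC z.1)
  calc _ = ∫ x in U, ∫ y in U, ψ x * (ρ y * f (x - y)) := by
        simp_rw [integral_const_mul, scalarConvOn, mul_comm]
    _ = ∫ y in U, ∫ x in U, ψ x * (ρ y * f (x - y)) := integral_integral_swap hiψ
    _ = _ := by
        simp_rw [← integral_const_mul]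
        refine integral_congr_ae (Eventually.of_forall fun y => ?_)
        refine integral_congr_ae (Eventually.of_forall fun x => ?_)
        simp only
        ring

/-- For `y ∈ U`, the translate `z ↦ φ (z + y)` of a test function on `U` is a test function on `U -
U`; change variables. -/
theorem HasWeakPartialDeriv.integral_comp_sub {i : Fin d} {f g : E d → ℝ}
    (hfg : HasWeakPartialDeriv (U - U) i f g) {φ : E d → ℝ} (hφ : IsTestFunction U φ) {y : E d}
    (hy : y ∈ U) :
    ∫ x in U, f (x - y) * fderiv ℝ φ x (EuclideanSpace.single i 1) =
      - ∫ x in U, g (x - y) * φ x := by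
  have hshift : ∀ k l : E d → ℝ, tsupport l ⊆ U →
      ∫ x in U, k (x - y) * l x = ∫ z in U - U, k z * l (z + y) := by
    intro k l hl
    rw [setIntegral_eq_integral_of_forall_compl_eq_zero,
      setIntegral_eq_integral_of_forall_compl_eq_zero,
      ← integral_sub_right_eq_self (fun z => k z * l (z + y)) y]
    · simp
    · intro z hz
      rw [image_eq_zero_of_notMem_tsupport (f := l), mul_zero]
      intro h
      exact hz ⟨z + y, hl h, y, hy, by simp⟩
    · intro x hx
      rw [image_eq_zero_of_notMem_tsupport (f := l) fun h => hx (hl h), mul_zero]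
  have htest : IsTestFunction (U - U) (fun z => φ (z + y)) := by
    refine ⟨hφ.1.comp (contDiff_id.add contDiff_const),
      hφ.2.1.comp_homeomorph (Homeomorph.addRight y), ?_⟩
    intro z hz
    have : z + y ∈ tsupport φ :=
      tsupport_comp_subset_preimage φ (f := fun z => z + y) (by fun_prop) hz
    exact ⟨z + y, hφ.2.2 this, y, hy, by simp⟩
  have h := hfg.2.2 _ htest
  simp_rw [fderiv_comp_add_right] at h
  rw [hshift f _ ((tsupport_fderiv_apply_subset ℝ _).trans hφ.2.2), hshift g _ hφ.2.2]
  exact h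

theorem hasWeakPartialDeriv_scalarConvOn (hU : IsOpen U) (hUb : Bornology.IsBounded U)
    {ρ f g : E d → ℝ} {i : Fin d} (hρ : MemLp ρ 2 (volume.restrict U))
    (hf : MemLp f 2 (volume.restrict (U - U))) (hg : MemLp g 2 (volume.restrict (U - U)))
    (hfg : HasWeakPartialDeriv (U - U) i f g) :
    HasWeakPartialDeriv U i (scalarConvOn U f ρ) (scalarConvOn U g ρ) := by
  have hloc : ∀ k, MemLp k 2 (volume.restrict (U - U)) →
      LocallyIntegrableOn (scalarConvOn U k ρ) U := fun k hk =>
    IntegrableOn.locallyIntegrableOn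
      (memLp_one_iff_integrable.1 (memLp_scalarConvOn hU hUb hρ hk 1))
  refine ⟨hloc f hf, hloc g hg, fun φ hφ => ?_⟩
  rw [integral_scalarConvOn_mul hU hUb hρ hf
    ((hφ.1.continuous_fderiv (by simp)).clm_apply continuous_const) (hφ.2.1.fderiv_apply ℝ _),
    integral_scalarConvOn_mul hU hUb hρ hg hφ.1.continuous hφ.2.1, ← integral_neg]
  refine setIntegral_congr_fun hU.measurableSet fun y hy => ?_
  simp only [hfg.integral_comp_sub hφ hy, mul_neg]

theorem convOn_apply {ρ : E d → ℝ} {F : E d → E d}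
    (hρ : MemLp ρ 2 (volume.restrict U)) (hF : MemLp F 2 (volume.restrict (U - U))) {x : E d}
    (hx : x ∈ U) (i : Fin d) :
    convOn U F ρ x i = scalarConvOn U (fun z => F z i) ρ x := by
  have hi : Integrable (fun y => ρ y • F (x - y)) (volume.restrict U) := by
    rw [← memLp_one_iff_integrable]
    exact (memLp_comp_sub hF hx).smul (q := 2) (p := 2) hρ
  exact ((EuclideanSpace.proj (𝕜 := ℝ) i : E d →L[ℝ] ℝ).integral_comp_comm hi).symm

/-- Reflection preserves null sets, so the equality holds at every `x ∈ U`, independently of the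
chosen representative of `∇W`. -/
theorem convOn_congr_ae {ρ : E d → ℝ} {F F' : E d → E d}
    (h : F =ᵐ[volume.restrict (U - U)] F') {x : E d} (hx : x ∈ U) :
    convOn U F ρ x = convOn U F' ρ x := by
  refine integral_congr_ae ?_
  filter_upwards [(quasiMeasurePreserving_sub_restrict hx).ae_eq_comp h] with y hy
  simp only [Function.comp_apply] at hy
  rw [hy]

/-- The fundamental lemma of the calculus of variations applied to `g - g'`. -/
theorem HasWeakPartialDeriv.ae_unique (hU : IsOpen U) {i : Fin d} {f g g' : E d → ℝ}
    (h : HasWeakPartialDeriv U i f g) (h' : HasWeakPartialDeriv U i f g') :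
    g =ᵐ[volume.restrict U] g' := by
  have key : ∀ᵐ x, x ∈ U → (g - g') x = 0 := by
    refine hU.ae_eq_zero_of_integral_contDiff_smul_eq_zero (h.2.1.sub h'.2.1)
      fun φ h1 h2 h3 => ?_
    have hφ : IsTestFunction U φ := ⟨h1, h2, h3⟩
    have hz : ∀ k : E d → ℝ, ∫ x in U, k x * φ x = ∫ x, φ x * k x := fun k => by
      rw [setIntegral_eq_integral_of_forall_compl_eq_zero fun x hx => by
        rw [image_eq_zero_of_notMem_tsupport fun hh => hx (h3 hh), mul_zero]]
      simp_rw [mul_comm]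
    have hint : ∀ {k : E d → ℝ}, LocallyIntegrableOn k U → Integrable fun x => φ x * k x := by
      intro k hk
      have h4 : IntegrableOn (fun x => φ x * k x) (tsupport φ) :=
        (hk.integrableOn_compact_subset h3 h2.isCompact).continuousOn_mul h1.continuous.continuousOn
          h2.isCompact
      refine (integrableOn_iff_integrable_of_support_subset ?_).1 h4
      exact (Function.support_mul_subset_left _ _).trans (subset_tsupport _)
    simp only [Pi.sub_apply, smul_eq_mul, mul_sub]
    rw [integral_sub (hint h.2.1) (hint h'.2.1), ← hz, ← hz]
    have e1 := h.2.2 φ hφ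
    have e2 := h'.2.2 φ hφ
    linarith
  rw [EventuallyEq, ae_restrict_iff' hU.measurableSet]
  filter_upwards [key] with x hx hxU
  exact sub_eq_zero.1 (hx hxU)

theorem HasWeakGradient.ae_unique (hU : IsOpen U) {f : E d → ℝ} {g g' : E d → E d}
    (h : HasWeakGradient U f g) (h' : HasWeakGradient U f g') : g =ᵐ[volume.restrict U] g' := by
  have : ∀ᵐ x ∂volume.restrict U, ∀ i, g x i = g' x i :=
    ae_all_iff.2 fun i => (h i).ae_unique hU (h' i)
  filter_upwards [this] with x hx
  ext i
  exact hx i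

theorem HasWeakPartialDeriv.linear_combination {i : Fin d} {f₁ f₂ g₁ g₂ : E d → ℝ}
    (h₁ : HasWeakPartialDeriv U i f₁ g₁) (h₂ : HasWeakPartialDeriv U i f₂ g₂)
    (hf₁ : MemLp f₁ 2 (volume.restrict U)) (hf₂ : MemLp f₂ 2 (volume.restrict U))
    (hg₁ : MemLp g₁ 2 (volume.restrict U)) (hg₂ : MemLp g₂ 2 (volume.restrict U)) (a c : ℝ) :
    HasWeakPartialDeriv U i (fun x => a * f₁ x + c * f₂ x) (fun x => a * g₁ x + c * g₂ x) := by
  refine ⟨(h₁.1.smul a).add (h₂.1.smul c), (h₁.2.1.smul a).add (h₂.2.1.smul c), fun φ hφ => ?_⟩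
  have hsplit : ∀ {k l ψ : E d → ℝ}, MemLp k 2 (volume.restrict U) →
      MemLp l 2 (volume.restrict U) → MemLp ψ 2 (volume.restrict U) →
      ∫ x in U, (a * k x + c * l x) * ψ x =
        a * (∫ x in U, k x * ψ x) + c * ∫ x in U, l x * ψ x := by
    intro k l ψ hk hl hψ
    have i1 : Integrable (fun x => k x * ψ x) (volume.restrict U) := hk.integrable_mul hψ
    have i2 : Integrable (fun x => l x * ψ x) (volume.restrict U) := hl.integrable_mul hψ
    rw [← integral_const_mul, ← integral_const_mul,
      ← integral_add (i1.const_mul a) (i2.const_mul c)]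
    refine integral_congr_ae (Eventually.of_forall fun x => ?_)
    simp only
    ring
  have hd : MemLp (fun x => fderiv ℝ φ x (EuclideanSpace.single i 1)) 2 (volume.restrict U) :=
    ((hφ.1.continuous_fderiv (by simp)).clm_apply
      continuous_const).memLp_of_hasCompactSupport (hφ.2.1.fderiv_apply ℝ _)
  rw [hsplit hf₁ hf₂ hd, hsplit hg₁ hg₂ (hφ.memLp _ 2), h₁.2.2 φ hφ, h₂.2.2 φ hφ]
  ring

end ConvolutionOn

/-! ### Stationary states of the nonlocal equation -/

section StationaryStates

variable {d : ℕ} {U : Set (E d)}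

theorem hasWeakGradient_zero : HasWeakGradient U (fun _ => 0) (fun _ => 0) := fun _ =>
  ⟨locallyIntegrableOn_zero, locallyIntegrableOn_zero, fun _ _ => by simp⟩

theorem isTestFunction_zero : IsTestFunction U (fun _ => 0) :=
  ⟨contDiff_const, HasCompactSupport.zero, by simp [tsupport]⟩

theorem memH10_zero : MemH10 U (fun _ => 0) :=
  ⟨MemLp.zero', fun _ => 0, hasWeakGradient_zero, MemLp.zero', fun _ _ => 0,
    fun _ => isTestFunction_zero, by simp, by simp⟩

theorem isStationaryState_zero {V W : E d → ℝ} (hV : MemH2 U V) (hW : MemH2 (U - U) W)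
    (A B C : ℝ) : IsStationaryState U V W A B C (fun _ => 0) := by
  obtain ⟨-, gV, hgV, -⟩ := hV
  obtain ⟨-, gW, hgW, -⟩ := hW
  exact ⟨memH10_zero, gV, gW, fun _ => 0, hgV, hgW, hasWeakGradient_zero, fun φ _ => by simp⟩

/-- Of the second derivatives only the diagonal ones are kept; their sum is the Laplacian. -/
theorem MemH2.exists_weakGradient {f : E d → ℝ} (hf : MemH2 U f) :
    ∃ (g : E d → E d) (h : Fin d → E d → ℝ), HasWeakGradient U f g ∧
      MemLp g 2 (volume.restrict U) ∧
      (∀ i, HasWeakPartialDeriv U i (fun x => g x i) (h i)) ∧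
      ∀ i, MemLp (h i) 2 (volume.restrict U) := by
  obtain ⟨-, g, hg, hg2, hgi⟩ := hf
  choose k hk hk2 using fun i => (hgi i).2
  exact ⟨g, fun i x => k i x i, hg, hg2, fun i => hk i i, fun i =>
    (EuclideanSpace.proj (𝕜 := ℝ) i : E d →L[ℝ] ℝ).comp_memLp' (hk2 i)⟩

/-- Freeze `ρ` inside the convolution: the drift becomes the gradient of the bounded potential `Φ`,
and the linear uniqueness result applies to `ρ` itself. -/
theorem IsStationaryState.ae_eq_zero (i₀ : Fin d) (hU : IsOpen U) (hUb : Bornology.IsBounded U)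
    {V W ρ : E d → ℝ} (hV : MemH2 U V) (hV' : MemLinfty U V) (hW : MemH2 (U - U) W)
    {A B C : ℝ} (hC : 0 < C) (h : IsStationaryState U V W A B C ρ) :
    ρ =ᵐ[volume.restrict U] fun _ => 0 := by
  obtain ⟨⟨hρ, gρ, hgρ, hgρ2, r, hr, hrρ, hrg⟩, gV', gW', gρ', hgV', hgW', hgρ', heq⟩ := h
  obtain ⟨gV, hV2, hgV, hgV2, hVi, hV2i⟩ := hV.exists_weakGradient
  obtain ⟨gW, hW2, hgW, hgW2, hWi, hW2i⟩ := hW.exists_weakGradient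
  have hUU : IsOpen (U - U) := hU.sub_right
  have hgVi : ∀ i, MemLp (fun x => gV x i) 2 (volume.restrict U) := fun i =>
    (EuclideanSpace.proj (𝕜 := ℝ) i : E d →L[ℝ] ℝ).comp_memLp' hgV2
  have hgWi : ∀ i, MemLp (fun x => gW x i) 2 (volume.restrict (U - U)) := fun i =>
    (EuclideanSpace.proj (𝕜 := ℝ) i : E d →L[ℝ] ℝ).comp_memLp' hgW2
  have hconv2 : ∀ {f : E d → ℝ}, MemLp f 2 (volume.restrict (U - U)) →
      MemLp (scalarConvOn U f ρ) 2 (volume.restrict U) := fun hf =>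
    memLp_scalarConvOn hU hUb hρ hf 2
  set Φ : E d → ℝ := fun x => A / C * V x + B / C * scalarConvOn U W ρ x with hΦdef
  set b : E d → E d := fun x => WithLp.toLp 2 fun i =>
    A / C * gV x i + B / C * scalarConvOn U (fun z => gW z i) ρ x with hbdef
  set h : Fin d → E d → ℝ := fun i x => A / C * hV2 i x + B / C * scalarConvOn U (hW2 i) ρ x
    with hhdef
  have hΦ2 : MemLp Φ 2 (volume.restrict U) :=
    (hV.1.const_mul (A / C)).add ((hconv2 hW.1).const_mul (B / C))
  have hb2 : MemLp b 2 (volume.restrict U) := by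
    rw [memLp_piLp_iff]
    exact fun i => ((hgVi i).const_mul (A / C)).add ((hconv2 (hgWi i)).const_mul (B / C))
  have hh2 : ∀ i, MemLp (h i) 2 (volume.restrict U) := fun i =>
    ((hV2i i).const_mul (A / C)).add ((hconv2 (hW2i i)).const_mul (B / C))
  have hΦb : HasWeakGradient U Φ b := fun i =>
    (hgV i).linear_combination (hasWeakPartialDeriv_scalarConvOn hU hUb hρ hW.1 (hgWi i) (hgW i))
      hV.1 (hconv2 hW.1) (hgVi i) (hconv2 (hgWi i)) _ _
  have hbh : ∀ i, HasWeakPartialDeriv U i (fun x => b x i) (h i) := fun i =>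
    (hVi i).linear_combination
      (hasWeakPartialDeriv_scalarConvOn hU hUb hρ (hgWi i) (hW2i i) (hWi i))
      (hgVi i) (hconv2 (hgWi i)) (hV2i i) (hconv2 (hW2i i)) _ _
  obtain ⟨M, hM, hΦM⟩ : ∃ M : ℝ, 0 ≤ M ∧ ∀ᵐ x ∂volume.restrict U, |Φ x| ≤ M := by
    set K := (eLpNorm ρ 2 (volume.restrict U) * eLpNorm W 2 (volume.restrict (U - U))).toReal
    set L := (eLpNorm V ⊤ (volume.restrict U)).toReal
    refine ⟨|A / C| * L + |B / C| * K, by positivity, ?_⟩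
    have hVL : ∀ᵐ x ∂volume.restrict U, |V x| ≤ L := by
      filter_upwards [ae_le_eLpNormEssSup (f := V) (μ := volume.restrict U)] with x hx
      rw [← eLpNorm_exponent_top] at hx
      have := ENNReal.toReal_mono hV'.2.ne hx
      rwa [toReal_enorm, Real.norm_eq_abs] at this
    filter_upwards [hVL, ae_restrict_mem hU.measurableSet] with x hx hxU
    refine (abs_add_le _ _).trans ?_
    rw [abs_mul, abs_mul]
    gcongr
    exact abs_scalarConvOn_le hρ hW.1 hxU
  refine ae_eq_zero_of_weak_solution (h := fun x => ∑ i, h i x) i₀ hU hUb hM hρ hgρ2 hr hrρ hrg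
    hΦb hΦM hΦ2 hb2 (memLp_finsetSum _ fun i _ => hh2 i)
    (fun φ hφ => integral_inner_gradient_eq_neg hb2 hh2 hbh hφ) fun φ hφ => ?_
  -- The gradients in the stationary equation are arbitrary representatives, so they are first
  -- replaced by those coming from `H²` and `H¹₀`.
  have hflux : ∀ᵐ x ∂volume.restrict U,
      inner ℝ (A • ρ x • gV' x + B • ρ x • convOn U gW' ρ x + C • gρ' x) (gradient φ x) =
        C * inner ℝ (gρ x + ρ x • b x) (gradient φ x) := by
    filter_upwards [hgV'.ae_unique hU hgV, hgρ'.ae_unique hU hgρ,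
      ae_restrict_mem hU.measurableSet] with x h1 h2 hxU
    rw [h1, h2, convOn_congr_ae (hgW'.ae_unique hUU hgW) hxU, ← real_inner_smul_left]
    congr 1
    ext i
    simp only [PiLp.add_apply, PiLp.smul_apply, smul_eq_mul, convOn_apply hρ hgW2 hxU, hbdef]
    field_simp
    ring
  have := heq φ hφ
  rw [integral_congr_ae hflux, integral_const_mul] at this
  exact (mul_eq_zero.1 this).resolve_left hC.ne'

end StationaryStates

end AggregationDiffusion

theorem theorem2 {d : ℕ} (hd : 1 ≤ d) (Ω : Set (AggregationDiffusion.E d))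
    (hΩ : IsCompact Ω) (hΩc : IsConnected Ω)
    (V W : AggregationDiffusion.E d → ℝ)
    (hV : AggregationDiffusion.MemH2 (interior Ω) V)
    (hV' : AggregationDiffusion.MemLinfty (interior Ω) V)
    (hW : AggregationDiffusion.MemH2 (interior Ω - interior Ω) W)
    (hW' : AggregationDiffusion.MemLinfty (interior Ω - interior Ω) W)
    (A B : ℝ) :
    ∃ C₀ : ℝ, 0 < C₀ ∧ ∀ C : ℝ, C₀ ≤ C →
      AggregationDiffusion.IsStationaryState (interior Ω) V W A B C (fun _ => 0) ∧
      ∀ ρ : AggregationDiffusion.E d → ℝ,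
        AggregationDiffusion.IsStationaryState (interior Ω) V W A B C ρ →
          ρ =ᵐ[volume.restrict (interior Ω)] (fun _ => 0) :=
  -- Any positive threshold would do; `d ≥ 1` provides the coordinate direction `0` for the
  -- Poincaré-type identity.
  ⟨1, one_pos, fun _ hC => ⟨AggregationDiffusion.isStationaryState_zero hV hW A B _, fun _ hρ =>
    hρ.ae_eq_zero ⟨0, hd⟩ isOpen_interior (hΩ.isBounded.subset interior_subset) hV hV' hW
      (one_pos.trans_le hC)⟩⟩
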